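/- Let $d\ge 1$, let $A=\mathbb C[z_1,\dots,z_d]$, and let $H^2=H^2(\mathbb C^d)$ be the symmetric Fock space over $\mathbb C^d$, realized as the completion of $A$ in the norm carried over from the symmetric tensor algebra of $\mathbb C^d$ by identifying the standard basis vector $e_k$ with $z_k$ (so the monomials are orthogonal and $\|z^\alpha\|^2=\alpha!/|\alpha|!$). A free Hilbert module is a Hilbert space $H^2\otimes E$ with $E$ a separable complex Hilbert space and with the action $f\cdot(g\otimes\zeta)=fg\otimes\zeta$ of $f\in A$. A bounded homomorphism of free Hilbert modules is a bounded operator $\Phi$ with $\Phi(f\cdot\xi)=f\cdot\Phi(\xi)$ for all $f\in A$; it is called an endomorphism if source and target are equal. Let $F=H^2\otimes C$ be a free Hilbert module. Let $\sigma$ be the normalized surface measure on the unit sphere $\partial B_d\subset\mathbb C^d$, let $\partial F=H^2(\partial B_d;C)$ be the closure of the $C$-valued holomorphic polynomials in $L^2(\partial B_d,\sigma;C)$, and let $Z_1,\dots,Z_d$ be the operators of multiplication by the coordinate functions on $\partial F$. Let $b:F\to\partial F$ be the bounded operator given by the natural inclusion of spaces of holomorphic functions (a polynomial is sent to its restriction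 to the sphere). For $X\in\mathcal B(F)$ put $\Gamma(X)=bXb^*$ and $$d\Gamma(X)=\Gamma(X)-\sum_{k=1}^d Z_k\,\Gamma(X)\,Z_k^*\in\mathcal B(\partial F).$$ Theorem 5.9. For every $X\in\mathcal B(F)$ the following are equivalent. (1) $d\Gamma(X)\ge 0$. (2) There is a sequence $\Phi_1,\Phi_2,\dots$ of bounded endomorphisms of $F$ such that $X=\sum_{n=1}^\infty\Phi_n\Phi_n^*$, the series converging in the strong operator topology. (3) There are a free Hilbert module $\tilde F$ and a bounded homomorphism $\Phi:\tilde F\to F$ such that $X=\Phi\Phi^*$. Corollary. Let $M$ be a closed submodule of $F$ (a closed subspace invariant under the action of $A$) and let $P_M$ be the orthogonal projection of $F$ onto $M$. Then there are a separable Hilbert space $E$ and a contractive homomorphism $\Phi:H^2\otimes E\to F$ which is a partial isometry, such that $P_M=\Phi\Phi^*$. -/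

import Mathlib

open MeasureTheory
open scoped InnerProductSpace ENNReal

universe u v

noncomputable section

/-! ### Symmetric Fock space and free Hilbert modules -/

/-- Words in the letters `0, …, d - 1`; the words of length `n` index the standard orthonormal
basis `e_{w 0} ⊗ ⋯ ⊗ e_{w (n-1)}` of the `n`-fold tensor power of `ℂ^d`. -/
abbrev Word (d : ℕ) : Type := Σ n : ℕ, (Fin n → Fin d)

/-- The word `k w` obtained by putting the letter `k` in front of `w`. -/
def consWord {d : ℕ} (k : Fin d) (w : Word d) : Word d :=
  ⟨w.1 + 1, Fin.cons k w.2⟩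

theorem consWord_injective {d : ℕ} (k : Fin d) : Function.Injective (consWord k) := by
  rintro ⟨n, w⟩ ⟨m, w'⟩ h
  have hn : n = m := by simpa [consWord] using congrArg Sigma.fst h
  subst hn
  have h2 := eq_of_heq (Sigma.mk.inj h).2
  have h3 : w = w' := (Fin.cons_inj.1 h2).2
  rw [h3]

/-- The coefficients of `e_k ⊗ f`. -/
def creationFun {d : ℕ} {E : Type u} [Zero E] (k : Fin d) (f : Word d → E) : Word d → E
  | ⟨0, _⟩ => 0
  | ⟨n + 1, w⟩ => if w 0 = k then f ⟨n, Fin.tail w⟩ else 0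

theorem creationFun_consWord {d : ℕ} {E : Type u} [Zero E] (k : Fin d) (f : Word d → E)
    (w : Word d) : creationFun k f (consWord k w) = f w := by
  obtain ⟨n, w⟩ := w
  simp [consWord, creationFun]

theorem creationFun_eq_zero {d : ℕ} {E : Type u} [Zero E] (k : Fin d) (f : Word d → E)
    (w : Word d) (hw : w ∉ Set.range (consWord k)) : creationFun k f w = 0 := by
  obtain ⟨n, w⟩ := w
  cases n with
  | zero => rfl
  | succ n =>
    have : w 0 ≠ k := by
      rintro rfl
      exact hw ⟨⟨n, Fin.tail w⟩, by simp [consWord]⟩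
    simp [creationFun, this]

section FullFock

variable (d : ℕ) (E : Type u) [NormedAddCommGroup E]

/-- The Hilbert direct sum over `n ≥ 0` of the spaces `(ℂ^d)^{⊗ n} ⊗ E`. An element `f` stands for
`∑_w e_w ⊗ f w`, the sum being over all words, and `‖f‖² = ∑_w ‖f w‖²`. -/
abbrev FullFock : Type u := lp (fun _ : Word d => E) 2

variable {d E}

theorem continuous_coeff (w : Word d) : Continuous fun f : FullFock d E => f w :=
  (continuous_apply w).comp lp.uniformContinuous_coe.continuous

theorem norm_sq_eq_tsum (f : FullFock d E) : ‖f‖ ^ 2 = ∑' w, ‖f w‖ ^ 2 := by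
  simpa using lp.norm_rpow_eq_tsum (p := 2) (by norm_num) f

theorem summable_norm_sq (f : FullFock d E) : Summable fun w => ‖f w‖ ^ 2 := by
  simpa using (memℓp_gen_iff (p := 2) (by norm_num)).1 (lp.memℓp f)

theorem hasSum_norm_degree (f : FullFock d E) :
    HasSum (fun n => ∑ w : Fin n → Fin d, ‖f ⟨n, w⟩‖ ^ 2) (‖f‖ ^ 2) := by
  rw [norm_sq_eq_tsum]
  exact (summable_norm_sq f).hasSum.sigma fun n => hasSum_fintype _

theorem creationFun_memℓp (k : Fin d) (f : FullFock d E) :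
    Memℓp (E := fun _ : Word d => E) (creationFun k f) 2 := by
  rw [memℓp_gen_iff (by norm_num)]
  rw [← (consWord_injective k).summable_iff]
  · simpa [Function.comp_def, creationFun_consWord] using summable_norm_sq f
  · intro w hw
    simp [creationFun_eq_zero k f w hw]

variable [InnerProductSpace ℂ E]

/-- Left creation operator `f ↦ e_k ⊗ f` on the full Fock space. -/
def creation (k : Fin d) : FullFock d E →L[ℂ] FullFock d E :=
  LinearMap.mkContinuous
    { toFun := fun f => ⟨creationFun k f, creationFun_memℓp k f⟩
      map_add' := by
        intro f g
        ext ⟨n, w⟩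
        change creationFun k (⇑(f + g)) ⟨n, w⟩ =
          creationFun k (⇑f) ⟨n, w⟩ + creationFun k (⇑g) ⟨n, w⟩
        cases n with
        | zero => simp [creationFun]
        | succ n =>
          by_cases h : w 0 = k <;> simp [creationFun, h]
      map_smul' := by
        intro c f
        ext ⟨n, w⟩
        change creationFun k (⇑(c • f)) ⟨n, w⟩ = c • creationFun k (⇑f) ⟨n, w⟩
        cases n with
        | zero => simp [creationFun]
        | succ n =>
          by_cases h : w 0 = k <;> simp [creationFun, h] }
    1 (by
      intro f
      rw [one_mul]
      refine (sq_le_sq₀ (norm_nonneg _) (norm_nonneg _)).1 (le_of_eq ?_)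
      rw [norm_sq_eq_tsum, norm_sq_eq_tsum]
      change ∑' w, ‖creationFun k f w‖ ^ 2 = _
      rw [← (consWord_injective k).tsum_eq]
      · simp [creationFun_consWord]
      · intro w hw
        by_contra h
        exact hw (by simp [creationFun_eq_zero k f w h]))

theorem creation_apply (k : Fin d) (f : FullFock d E) (w : Word d) :
    creation k f w = creationFun k f w := rfl

end FullFock

section FreeModule

variable (d : ℕ) (E : Type u) [NormedAddCommGroup E] [InnerProductSpace ℂ E]

/-- The symmetric tensors: those whose coefficients do not change when the letters of a
word are permuted. -/
def symTensors : Submodule ℂ (FullFock d E) where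
  carrier := {f | ∀ (n : ℕ) (τ : Equiv.Perm (Fin n)) (w : Fin n → Fin d),
    f ⟨n, w ∘ τ⟩ = f ⟨n, w⟩}
  add_mem' := by
    intro f g hf hg n τ w
    simp [hf n τ w, hg n τ w]
  zero_mem' := by
    intro n τ w
    simp
  smul_mem' := by
    intro c f hf n τ w
    simp [hf n τ w]

/-- The free Hilbert module `H² ⊗ E`. Here `H² = H²(ℂ^d)` is the symmetric Fock space over
`ℂ^d`, that is, the completion of the space of polynomials in the norm carried over from the
symmetric tensor algebra, and the elements of `H² ⊗ E` are written as symmetric tensors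
with coefficients in `E`. The symmetric tensor with coefficients `f w` is identified with the
`E`-valued power series `∑_w z_w f(w)`, where `z_w = z_{w 0} ⋯ z_{w (n-1)}`. -/
abbrev FreeModule : Type u := ↥(symTensors d E)

theorem isClosed_symTensors : IsClosed (symTensors d E : Set (FullFock d E)) := by
  have : (symTensors d E : Set (FullFock d E)) =
      ⋂ (n : ℕ) (τ : Equiv.Perm (Fin n)) (w : Fin n → Fin d),
        {f : FullFock d E | f ⟨n, w ∘ τ⟩ = f ⟨n, w⟩} := by
    ext f
    simp only [Set.mem_iInter, Set.mem_ofPred_eq]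
    exact Iff.rfl
  rw [this]
  exact isClosed_iInter fun n => isClosed_iInter fun τ => isClosed_iInter fun w =>
    isClosed_eq (continuous_coeff _) (continuous_coeff _)

variable [CompleteSpace E]

instance completeSpace_symTensors : CompleteSpace (symTensors d E) :=
  (isClosed_symTensors d E).completeSpace_coe

variable {d E}

/-- Multiplication by the coordinate function `z_k` on `H² ⊗ E`, that is, symmetric tensoring with
the basis vector `e_k`: the orthogonal projection of `e_k ⊗ ξ` to the symmetric tensors. -/
def coordMul (k : Fin d) : FreeModule d E →L[ℂ] FreeModule d E :=
  ((symTensors d E).orthogonalProjectionOnto ∘L creation k) ∘L (symTensors d E).subtypeL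

theorem inner_coordMul (k : Fin d) (η ξ : FreeModule d E) :
    ⟪η, coordMul k ξ⟫_ℂ = ∑' w, ⟪η.1 (consWord k w), ξ.1 w⟫_ℂ := by
  have h1 : ⟪η, coordMul k ξ⟫_ℂ = ⟪(η : FullFock d E), creation k (ξ : FullFock d E)⟫_ℂ := by
    rw [coordMul]
    simp only [ContinuousLinearMap.comp_apply, Submodule.subtypeL_apply]
    exact Submodule.inner_orthogonalProjectionOnto_eq_of_mem_left _ _
  rw [h1, lp.inner_eq_tsum, ← (consWord_injective k).tsum_eq]
  · simp [creation_apply, creationFun_consWord]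
  · intro w hw
    by_contra h
    exact hw (by simp [creation_apply, creationFun_eq_zero k _ w h])

theorem adjoint_coordMul_apply (k : Fin d) (η : FreeModule d E) (w : Word d) :
    ((coordMul k).adjoint η).1 w = η.1 (consWord k w) := by
  have hmem : Memℓp (E := fun _ : Word d => E) (fun w => η.1 (consWord k w)) 2 := by
    rw [memℓp_gen_iff (by norm_num)]
    have := (summable_norm_sq (η : FullFock d E)).comp_injective (consWord_injective k)
    simpa [Function.comp_def] using this
  let g : FullFock d E := ⟨fun w => η.1 (consWord k w), hmem⟩
  have hg : g ∈ symTensors d E := by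
    intro n τ w
    change η.1 ⟨n + 1, Fin.cons k (w ∘ τ)⟩ = η.1 ⟨n + 1, Fin.cons k w⟩
    have h := η.2 (n + 1) (Equiv.Perm.decomposeFin.symm (0, τ)) (Fin.cons k w)
    rw [← h]
    refine congrArg (fun v => η.1 ⟨n + 1, v⟩) ?_
    funext i
    refine Fin.cases ?_ (fun i => ?_) i <;> simp
  have key : (coordMul k).adjoint η = ⟨g, hg⟩ := by
    refine ext_inner_right ℂ fun ξ => ?_
    rw [ContinuousLinearMap.adjoint_inner_left, inner_coordMul, Submodule.coe_inner,
      lp.inner_eq_tsum]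
  rw [key]

theorem coordMul_comm (j k : Fin d) :
    (coordMul j * coordMul k : FreeModule d E →L[ℂ] FreeModule d E) =
      coordMul k * coordMul j := by
  have h : (coordMul k).adjoint ∘L (coordMul j).adjoint =
      (coordMul j).adjoint ∘L (coordMul k : FreeModule d E →L[ℂ] FreeModule d E).adjoint := by
    ext η w
    obtain ⟨n, w⟩ := w
    simp only [ContinuousLinearMap.comp_apply, adjoint_coordMul_apply]
    have h := η.2 (n + 2) (Equiv.swap 0 1) (Fin.cons j (Fin.cons k w))
    change η.1 ⟨n + 2, Fin.cons j (Fin.cons k w)⟩ = η.1 ⟨n + 2, Fin.cons k (Fin.cons j w)⟩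
    rw [← h]
    refine congrArg (fun v => η.1 ⟨n + 2, v⟩) ?_
    funext i
    refine Fin.cases ?_ (fun i => Fin.cases ?_ (fun i => ?_) i) i
    · simp
    · simp
    · simp [Equiv.swap_apply_of_ne_of_ne, Fin.ext_iff]
  have h2 := congrArg ContinuousLinearMap.adjoint h
  simpa [ContinuousLinearMap.adjoint_comp, ContinuousLinearMap.mul_def] using h2

variable (d E)

open scoped IsMulCommutative in
/-- The action of polynomials on `H² ⊗ E`, `f · (g ⊗ ζ) = f g ⊗ ζ`: the homomorphism of unital
algebras that sends the variable `z_k` to multiplication by `z_k`. -/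
def polyRep : MvPolynomial (Fin d) ℂ →ₐ[ℂ] (FreeModule d E →L[ℂ] FreeModule d E) :=
  haveI : IsMulCommutative (Algebra.adjoin ℂ
      (Set.range (coordMul : Fin d → FreeModule d E →L[ℂ] FreeModule d E))) :=
    Algebra.isMulCommutative_adjoin ℂ (by
      rintro _ ⟨j, rfl⟩ _ ⟨k, rfl⟩
      exact coordMul_comm j k)
  (Subalgebra.val _).comp (MvPolynomial.aeval fun k =>
    (⟨coordMul k, Algebra.subset_adjoin (Set.mem_range_self k)⟩ :
      Algebra.adjoin ℂ (Set.range (coordMul : Fin d → FreeModule d E →L[ℂ] FreeModule d E))))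

theorem polyRep_X (k : Fin d) : polyRep d E (MvPolynomial.X k) = coordMul k := by
  simp [polyRep]

end FreeModule

/-- A bounded homomorphism of free Hilbert modules: a bounded operator that commutes with the
action of polynomials. -/
def IsModuleHom {d : ℕ} {E : Type v} {C : Type u}
    [NormedAddCommGroup E] [InnerProductSpace ℂ E] [CompleteSpace E]
    [NormedAddCommGroup C] [InnerProductSpace ℂ C] [CompleteSpace C]
    (Φ : FreeModule d E →L[ℂ] FreeModule d C) : Prop :=
  ∀ (f : MvPolynomial (Fin d) ℂ) (ξ : FreeModule d E),
    Φ (polyRep d E f ξ) = polyRep d C f (Φ ξ)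

/-- A closed subspace that is invariant under the action of polynomials. -/
def IsSubmoduleOf {d : ℕ} {C : Type u}
    [NormedAddCommGroup C] [InnerProductSpace ℂ C] [CompleteSpace C]
    (M : ClosedSubmodule ℂ (FreeModule d C)) : Prop :=
  ∀ (f : MvPolynomial (Fin d) ℂ), ∀ ξ ∈ M, polyRep d C f ξ ∈ M

/-- A partial isometry: isometric on the orthogonal complement of its kernel. -/
def IsPartialIsometry {H : Type v} {K : Type u}
    [NormedAddCommGroup H] [InnerProductSpace ℂ H] [NormedAddCommGroup K] [InnerProductSpace ℂ K]
    (Φ : H →L[ℂ] K) : Prop :=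
  ∀ ξ ∈ Φ.kerᗮ, ‖Φ ξ‖ = ‖ξ‖

/-! ### The Hardy space of the sphere -/

/-- The unit sphere of `ℂ^d`. -/
abbrev UnitSphere (d : ℕ) : Type := Metric.sphere (0 : EuclideanSpace ℂ (Fin d)) 1

/-- The surface measure of the unit sphere, normalized to total mass one. -/
def sphereMeasure (d : ℕ) : Measure (UnitSphere d) :=
  ((volume : Measure (EuclideanSpace ℂ (Fin d))).toSphere Set.univ)⁻¹ •
    (volume : Measure (EuclideanSpace ℂ (Fin d))).toSphere

instance sphereMeasure_isFinite (d : ℕ) : IsFiniteMeasure (sphereMeasure d) := by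
  constructor
  rw [sphereMeasure, Measure.smul_apply, smul_eq_mul]
  exact (ENNReal.inv_mul_le_one _).trans_lt ENNReal.one_lt_top

theorem sphereMeasure_univ_le (d : ℕ) : sphereMeasure d Set.univ ≤ 1 := by
  rw [sphereMeasure, Measure.smul_apply, smul_eq_mul]
  exact ENNReal.inv_mul_le_one _

/-- Rotation of the unit sphere by a complex number of modulus one. -/
def rotate {d : ℕ} (c : Circle) (z : UnitSphere d) : UnitSphere d :=
  ⟨(c : ℂ) • z.1, by rw [mem_sphere_zero_iff_norm, norm_smul, norm_eq_of_mem_sphere z, Circle.norm_coe,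
    one_mul]⟩

theorem continuous_rotate {d : ℕ} (c : Circle) : Continuous (rotate c : UnitSphere d → _) := by
  unfold rotate
  fun_prop

open scoped Pointwise in
theorem measurePreserving_rotate {d : ℕ} (c : Circle) :
    MeasurePreserving (rotate c) (sphereMeasure d) (sphereMeasure d) := by
  have h0 : MeasurePreserving (rotate c) (volume : Measure (EuclideanSpace ℂ (Fin d))).toSphere
      (volume : Measure (EuclideanSpace ℂ (Fin d))).toSphere := by
    refine ⟨(continuous_rotate c).measurable, ?_⟩
    ext s hs
    rw [Measure.map_apply (continuous_rotate c).measurable hs,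
      Measure.toSphere_apply' _ hs,
      Measure.toSphere_apply' _ ((continuous_rotate c).measurable hs)]
    congr 1
    let U : EuclideanSpace ℂ (Fin d) ≃ₗᵢ[ℝ] EuclideanSpace ℂ (Fin d) :=
      LinearIsometryEquiv.piLpCongrRight 2 fun _ => rotation c
    have hU : ∀ z, U z = (c : ℂ) • z := by
      intro z
      ext i
      simp [U, rotation_apply]
    have hpre : Set.Ioo (0 : ℝ) 1 • (Subtype.val '' (rotate c ⁻¹' s)) =
        U ⁻¹' (Set.Ioo (0 : ℝ) 1 • (Subtype.val '' s)) := by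
      ext z
      constructor
      · rintro ⟨r, hr, _, ⟨y, hy, rfl⟩, rfl⟩
        refine ⟨r, hr, _, ⟨rotate c y, hy, rfl⟩, ?_⟩
        change r • ((c : ℂ) • y.1) = U (r • y.1)
        rw [hU, smul_comm]
      · rintro ⟨r, hr, _, ⟨y, hy, rfl⟩, hz⟩
        refine ⟨r, hr, _, ⟨rotate c⁻¹ y, ?_, rfl⟩, ?_⟩
        · have : rotate c (rotate c⁻¹ y) = y := by
            ext1
            simp [rotate, smul_smul]
          simpa [this] using hy
        · apply U.injective
          rw [← hz]
          change U (r • (((c⁻¹ : Circle) : ℂ) • y.1)) = r • y.1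
          rw [map_smul, hU, smul_smul, ← Circle.coe_mul, mul_inv_cancel, Circle.coe_one, one_smul]
    rw [hpre]
    exact U.measurePreserving.measure_preimage_equiv (f := U.toHomeomorph.toMeasurableEquiv) _
  exact h0.smul_measure _

section Hardy

variable (d : ℕ) (C : Type u) [NormedAddCommGroup C] [InnerProductSpace ℂ C]

/-- The restriction to the sphere of the vector-valued polynomial `z ↦ p(z) c`. -/
def polyFun (p : MvPolynomial (Fin d) ℂ) (c : C) : C(UnitSphere d, C) where
  toFun z := MvPolynomial.eval (fun i => z.1 i) p • c
  continuous_toFun := by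
    refine Continuous.smul ?_ continuous_const
    refine (MvPolynomial.continuous_eval p).comp ?_
    fun_prop

/-- The class in `L²(σ; C)` of a continuous function on the sphere. -/
abbrev sphereToLp : C(UnitSphere d, C) →L[ℂ] Lp C 2 (sphereMeasure d) :=
  ContinuousMap.toLp 2 (sphereMeasure d) ℂ

/-- The `C`-valued holomorphic polynomials, as a subspace of `L²(σ; C)`. -/
def hardyPolys : Submodule ℂ (Lp C 2 (sphereMeasure d)) :=
  Submodule.span ℂ (Set.range fun q : MvPolynomial (Fin d) ℂ × C =>
    sphereToLp d C (polyFun d C q.1 q.2))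

/-- The Hardy space `H²(∂B_d; C)`: the closure in `L²(σ; C)` of the holomorphic polynomials. -/
abbrev Hardy : Type u := ↥(hardyPolys d C).topologicalClosure

/-- Multiplication by the coordinate `z_k` on `L²(σ; C)`. -/
def coordMulL2 (k : Fin d) : Lp C 2 (sphereMeasure d) →L[ℂ] Lp C 2 (sphereMeasure d) :=
  (ContinuousLinearMap.lsmul ℂ ℂ : ℂ →L[ℂ] C →L[ℂ] C).holderL (sphereMeasure d) ⊤ 2 2
    (ContinuousMap.toLp ⊤ (sphereMeasure d) ℂ (polyFun d ℂ (MvPolynomial.X k) 1))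

theorem coordMulL2_coe (k : Fin d) (f : Lp C 2 (sphereMeasure d)) :
    coordMulL2 d C k f =ᵐ[sphereMeasure d] fun z => z.1 k • f z := by
  have h1 := ContinuousMap.coeFn_toLp (p := ⊤) (𝕜 := ℂ) (sphereMeasure d)
    (polyFun d ℂ (MvPolynomial.X k) 1)
  have h2 := (ContinuousLinearMap.lsmul ℂ ℂ : ℂ →L[ℂ] C →L[ℂ] C).coeFn_holder (r := 2)
    (ContinuousMap.toLp ⊤ (sphereMeasure d) ℂ (polyFun d ℂ (MvPolynomial.X k) 1)) f
  filter_upwards [h1, h2] with z hz1 hz2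
  change (ContinuousLinearMap.holder 2 _ _ f : _ → C) z = _
  rw [hz2, hz1]
  simp [polyFun]

theorem coordMulL2_poly (k : Fin d) (p : MvPolynomial (Fin d) ℂ) (c : C) :
    coordMulL2 d C k (sphereToLp d C (polyFun d C p c)) =
      sphereToLp d C (polyFun d C (MvPolynomial.X k * p) c) := by
  apply Lp.ext
  filter_upwards [coordMulL2_coe d C k (sphereToLp d C (polyFun d C p c)),
    ContinuousMap.coeFn_toLp (p := 2) (𝕜 := ℂ) (sphereMeasure d) (polyFun d C p c),
    ContinuousMap.coeFn_toLp (p := 2) (𝕜 := ℂ) (sphereMeasure d)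
      (polyFun d C (MvPolynomial.X k * p) c)] with z h1 h2 h3
  rw [h1, h2, h3]
  simp [polyFun, mul_smul]

theorem coordMulL2_mem (k : Fin d) (f : Lp C 2 (sphereMeasure d))
    (hf : f ∈ (hardyPolys d C).topologicalClosure) :
    coordMulL2 d C k f ∈ (hardyPolys d C).topologicalClosure := by
  have hmaps : Set.MapsTo (coordMulL2 d C k) (hardyPolys d C : Set _) (hardyPolys d C) := by
    intro g hg
    have hle : hardyPolys d C ≤ (hardyPolys d C).comap (coordMulL2 d C k).toLinearMap := by
      conv_lhs => rw [hardyPolys]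
      rw [Submodule.span_le]
      rintro _ ⟨q, rfl⟩
      change coordMulL2 d C k (sphereToLp d C (polyFun d C q.1 q.2)) ∈ hardyPolys d C
      rw [coordMulL2_poly]
      exact Submodule.subset_span ⟨(MvPolynomial.X k * q.1, q.2), rfl⟩
    exact hle hg
  exact hmaps.closure (coordMulL2 d C k).continuous hf

/-- The canonical operator `Z_k` of the Hardy space: multiplication by the coordinate `z_k`. -/
def hardyMul (k : Fin d) : Hardy d C →L[ℂ] Hardy d C :=
  (coordMulL2 d C k ∘L (hardyPolys d C).topologicalClosure.subtypeL).codRestrict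
    (hardyPolys d C).topologicalClosure fun f => coordMulL2_mem d C k f f.2

variable {d C}

/-- The homogeneous component of degree `n` of the power series `∑_w z_w f(w)`, restricted to the
sphere: the polynomial `∑ z_{w 0} ⋯ z_{w (n-1)} f(w)`, the sum being over the words of
length `n`. -/
def homComponent (n : ℕ) (f : FullFock d C) : C(UnitSphere d, C) where
  toFun z := ∑ w : Fin n → Fin d, (∏ i, z.1 (w i)) • f ⟨n, w⟩
  continuous_toFun := by fun_prop

/-- The same component, as an element of `L²(σ; C)`. -/
def homLp (n : ℕ) : FullFock d C →ₗ[ℂ] Lp C 2 (sphereMeasure d) where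
  toFun f := sphereToLp d C (homComponent n f)
  map_add' f g := by
    rw [← map_add]
    congr 1
    ext z
    simp [homComponent, Finset.sum_add_distrib]
  map_smul' c f := by
    rw [RingHom.id_apply, ← map_smul]
    congr 1
    ext z
    change ∑ w : Fin n → Fin d, (∏ i, z.1 (w i)) • (c • f ⟨n, w⟩) =
      c • ∑ w : Fin n → Fin d, (∏ i, z.1 (w i)) • f ⟨n, w⟩
    rw [Finset.smul_sum]
    exact Finset.sum_congr rfl fun w _ => smul_comm _ _ _

theorem homLp_mem (n : ℕ) (f : FullFock d C) : homLp n f ∈ hardyPolys d C := by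
  have h : homComponent n f = ∑ w : Fin n → Fin d,
      polyFun d C (∏ i, MvPolynomial.X (w i)) (f ⟨n, w⟩) := by
    ext z
    simp [homComponent, polyFun]
  change sphereToLp d C (homComponent n f) ∈ _
  rw [h, map_sum]
  exact Submodule.sum_mem _ fun w _ => Submodule.subset_span ⟨(_, _), rfl⟩

theorem sum_norm_word (n : ℕ) (z : UnitSphere d) :
    ∑ w : Fin n → Fin d, ‖∏ i, z.1 (w i)‖ ^ 2 = 1 := by
  have h1 : ∑ k, ‖z.1 k‖ ^ 2 = 1 := by
    rw [← EuclideanSpace.norm_sq_eq, norm_eq_of_mem_sphere z, one_pow]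
  have h2 := Finset.prod_univ_sum (fun _ : Fin n => (Finset.univ : Finset (Fin d)))
    (fun _ k => ‖z.1 k‖ ^ 2)
  simp only [h1, Finset.prod_const_one, Fintype.piFinset_univ] at h2
  refine Eq.trans ?_ h2.symm
  simp [Finset.prod_pow]

theorem norm_homComponent_sq_le (n : ℕ) (f : FullFock d C) (z : UnitSphere d) :
    ‖homComponent n f z‖ ^ 2 ≤ ∑ w : Fin n → Fin d, ‖f ⟨n, w⟩‖ ^ 2 := by
  have h1 : ‖homComponent n f z‖ ≤ ∑ w : Fin n → Fin d, ‖∏ i, z.1 (w i)‖ * ‖f ⟨n, w⟩‖ := by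
    refine (norm_sum_le _ _).trans (le_of_eq ?_)
    simp [norm_smul]
  calc ‖homComponent n f z‖ ^ 2
      ≤ (∑ w : Fin n → Fin d, ‖∏ i, z.1 (w i)‖ * ‖f ⟨n, w⟩‖) ^ 2 := by gcongr
    _ ≤ (∑ w : Fin n → Fin d, ‖∏ i, z.1 (w i)‖ ^ 2) * ∑ w : Fin n → Fin d, ‖f ⟨n, w⟩‖ ^ 2 :=
        Finset.sum_mul_sq_le_sq_mul_sq _ _ _
    _ = _ := by rw [sum_norm_word, one_mul]

theorem norm_homLp_sq_le (n : ℕ) (f : FullFock d C) :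
    ‖homLp n f‖ ^ 2 ≤ ∑ w : Fin n → Fin d, ‖f ⟨n, w⟩‖ ^ 2 := by
  set R := ∑ w : Fin n → Fin d, ‖f ⟨n, w⟩‖ ^ 2 with hR
  have hR0 : 0 ≤ R := Finset.sum_nonneg fun _ _ => sq_nonneg _
  have hb : ∀ᵐ z ∂(sphereMeasure d), ‖homLp n f z‖ ≤ √R := by
    filter_upwards [ContinuousMap.coeFn_toLp (p := 2) (𝕜 := ℂ) (sphereMeasure d)
      (homComponent n f)] with z hz
    change ‖sphereToLp d C (homComponent n f) z‖ ≤ _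
    rw [hz]
    exact Real.le_sqrt_of_sq_le (norm_homComponent_sq_le n f z)
  have h := Lp.norm_le_of_ae_bound (p := 2) (Real.sqrt_nonneg R) hb
  have hm : measureUnivNNReal (sphereMeasure d) ≤ 1 := by
    rw [← ENNReal.coe_le_coe, coe_measureUnivNNReal]
    exact sphereMeasure_univ_le d
  have h' : ‖homLp n f‖ ≤ √R := by
    refine h.trans (mul_le_of_le_one_left (Real.sqrt_nonneg R) ?_)
    exact NNReal.rpow_le_one hm (by positivity)
  calc ‖homLp n f‖ ^ 2 ≤ √R ^ 2 := by gcongr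
    _ = R := Real.sq_sqrt hR0

theorem homComponent_rotate (n : ℕ) (f : FullFock d C) (c : Circle) (z : UnitSphere d) :
    homComponent n f (rotate c z) = (c : ℂ) ^ n • homComponent n f z := by
  simp [homComponent, rotate, Finset.prod_mul_distrib, Finset.smul_sum, smul_smul]

theorem inner_homLp_of_ne {n m : ℕ} (h : n ≠ m) (f g : FullFock d C) :
    ⟪homLp n f, homLp m g⟫_ℂ = 0 := by
  have h0 : ⟪homLp n f, homLp m g⟫_ℂ =
      ∫ z, ⟪homComponent n f z, homComponent m g z⟫_ℂ ∂(sphereMeasure d) := by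
    rw [L2.inner_def]
    refine integral_congr_ae ?_
    filter_upwards [ContinuousMap.coeFn_toLp (p := 2) (𝕜 := ℂ) (sphereMeasure d)
      (homComponent n f), ContinuousMap.coeFn_toLp (p := 2) (𝕜 := ℂ) (sphereMeasure d)
      (homComponent m g)] with z h1 h2
    change ⟪sphereToLp d C (homComponent n f) z, sphereToLp d C (homComponent m g) z⟫_ℂ = _
    rw [h1, h2]
  let c : Circle := Circle.exp (Real.pi / ((m : ℝ) - n))
  have hnm : (m : ℝ) - n ≠ 0 := sub_ne_zero.2 (by exact_mod_cast h.symm)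
  have hc : (starRingEnd ℂ) ((c : ℂ) ^ n) * (c : ℂ) ^ m = -1 := by
    have h1 : (starRingEnd ℂ) (c : ℂ) = Complex.exp (-(Real.pi / ((m : ℝ) - n) : ℝ) * Complex.I) := by
      rw [← Circle.coe_inv_eq_conj, ← Circle.exp_neg, Circle.coe_exp]
      push_cast
      rfl
    rw [map_pow, h1, Circle.coe_exp, ← Complex.exp_nat_mul, ← Complex.exp_nat_mul,
      ← Complex.exp_add, ← Complex.exp_pi_mul_I]
    congr 1
    have hnm' : (m : ℂ) - n ≠ 0 := by exact_mod_cast hnm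
    push_cast
    field_simp
    ring
  have hcont : Continuous fun z => ⟪homComponent n f z, homComponent m g z⟫_ℂ := by fun_prop
  have h1 : ∫ z, ⟪homComponent n f (rotate c z), homComponent m g (rotate c z)⟫_ℂ
      ∂(sphereMeasure d) =
      ∫ z, ⟪homComponent n f z, homComponent m g z⟫_ℂ ∂(sphereMeasure d) := by
    conv_rhs => rw [← (measurePreserving_rotate (d := d) c).map_eq]
    rw [integral_map (continuous_rotate c).aemeasurable hcont.aestronglyMeasurable]
  have h2 : ∀ z : UnitSphere d,
      ⟪homComponent n f (rotate c z), homComponent m g (rotate c z)⟫_ℂ =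
        - ⟪homComponent n f z, homComponent m g z⟫_ℂ := by
    intro z
    rw [homComponent_rotate, homComponent_rotate, inner_smul_left, inner_smul_right, ← mul_assoc,
      hc, neg_one_mul]
  simp only [h2, integral_neg] at h1
  rw [h0]
  exact self_eq_neg.1 h1.symm

theorem orthogonalFamily_homLp : OrthogonalFamily ℂ
    (fun n => LinearMap.range (homLp n : FullFock d C →ₗ[ℂ] _))
    fun n => (LinearMap.range (homLp n : FullFock d C →ₗ[ℂ] _)).subtypeₗᵢ := by
  rintro n m h ⟨_, f, rfl⟩ ⟨_, g, rfl⟩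
  exact inner_homLp_of_ne h f g

variable [CompleteSpace C]

theorem summable_homLp (f : FullFock d C) : Summable fun n => homLp n f := by
  have h := (orthogonalFamily_homLp (d := d) (C := C)).summable_iff_norm_sq_summable
    fun n => ⟨homLp n f, f, rfl⟩
  refine h.2 ?_
  exact Summable.of_nonneg_of_le (fun n => sq_nonneg _) (fun n => norm_homLp_sq_le n f)
    (hasSum_norm_degree f).summable

theorem norm_tsum_homLp_le (f : FullFock d C) : ‖∑' n, homLp n f‖ ≤ ‖f‖ := by
  have hs : Summable fun n => ‖homLp n f‖ ^ 2 :=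
    Summable.of_nonneg_of_le (fun n => sq_nonneg _) (fun n => norm_homLp_sq_le n f)
      (hasSum_norm_degree f).summable
  refine (sq_le_sq₀ (norm_nonneg _) (norm_nonneg _)).1 ?_
  have h1 : Filter.Tendsto (fun s : Finset ℕ => ‖∑ n ∈ s, homLp n f‖ ^ 2) Filter.atTop
      (nhds (‖∑' n, homLp n f‖ ^ 2)) := ((summable_homLp f).hasSum.norm).pow 2
  refine le_of_tendsto h1 (Filter.Eventually.of_forall fun s => ?_)
  have h2 := (orthogonalFamily_homLp (d := d) (C := C)).norm_sum
    (fun n => ⟨homLp n f, f, rfl⟩) s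
  change ‖∑ n ∈ s, homLp n f‖ ^ 2 = ∑ n ∈ s, ‖homLp n f‖ ^ 2 at h2
  rw [h2]
  calc ∑ n ∈ s, ‖homLp n f‖ ^ 2 ≤ ∑ n ∈ s, ∑ w : Fin n → Fin d, ‖f ⟨n, w⟩‖ ^ 2 :=
        Finset.sum_le_sum fun n _ => norm_homLp_sq_le n f
    _ ≤ ‖f‖ ^ 2 := sum_le_hasSum _ (fun n _ => Finset.sum_nonneg fun w _ => sq_nonneg _)
        (hasSum_norm_degree f)

theorem tsum_homLp_mem (f : FullFock d C) :
    ∑' n, homLp n f ∈ (hardyPolys d C).topologicalClosure := by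
  refine (hardyPolys d C).isClosed_topologicalClosure.mem_of_tendsto (summable_homLp f).hasSum
    (Filter.Eventually.of_forall fun s => ?_)
  exact Submodule.sum_mem _ fun n _ => Submodule.le_topologicalClosure _ (homLp_mem n f)

variable (d C)

/-- The inclusion `b : H² ⊗ C → H²(∂B_d; C)`, both spaces being regarded as spaces of holomorphic
functions: it sends the power series `∑_n ξ_n`, with `ξ_n` homogeneous of degree `n`, to the sum
in `L²(σ; C)` of the restrictions of the polynomials `ξ_n` to the sphere. -/
def inclusion : FreeModule d C →L[ℂ] Hardy d C :=
  LinearMap.mkContinuous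
    { toFun := fun ξ => ⟨∑' n, homLp n ξ.1, tsum_homLp_mem ξ.1⟩
      map_add' := by
        intro ξ η
        ext1
        simp [(summable_homLp ξ.1).tsum_add (summable_homLp η.1)]
      map_smul' := by
        intro c ξ
        ext1
        simp [(summable_homLp ξ.1).tsum_const_smul c] }
    1 (by
      intro ξ
      rw [one_mul]
      exact norm_tsum_homLp_le ξ.1)

variable {d C}

/-- `Γ(X) = b X b*`. -/
def gammaOp (X : FreeModule d C →L[ℂ] FreeModule d C) : Hardy d C →L[ℂ] Hardy d C :=
  inclusion d C ∘L X ∘L (inclusion d C).adjoint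

/-- `dΓ(X) = Γ(X) - ∑_k Z_k Γ(X) Z_k*`. -/
def dGamma (X : FreeModule d C →L[ℂ] FreeModule d C) : Hardy d C →L[ℂ] Hardy d C :=
  gammaOp X - ∑ k : Fin d, hardyMul d C k ∘L gammaOp X ∘L (hardyMul d C k).adjoint

end Hardy

end

noncomputable section

/-! ### Separability and coordinates -/

/-! Write `T_k` for `coordMul k`, `b` for `inclusion` and `D = X - ∑ T_k X T_k*` for `defect X`.
Since `b T_k = Z_k b`, one has `dΓ(X) = b D b*` (`dGamma_eq`). A power series whose restriction to
the sphere vanishes is zero, so `b` is injective and `b*` has dense range. Positivity of `dΓ(X)` is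
therefore positivity of `D` (`isPositive_dGamma_iff`), and everything takes place on the free
module.

If `D ≥ 0`, factor `D = R* R` through an `ℓ²` space `E`. Iterating `X = D + ∑ T_k X T_k*` gives
`⟪Xξ, ξ⟫ = ∑_w ‖R T_w* ξ‖²` over all words: the remainder after `N` steps is at most `‖X‖` times a
tail of the series for `‖ξ‖²`. Hence `L ξ = ∑_w e_w ⊗ R T_w* ξ` is bounded into `H² ⊗ E` with `L* L
= X` (`adjoint_orbitMap_comp`). It intertwines the `T_k*`, so `Φ = L*` is a homomorphism with `Φ Φ*
= X`. Conversely, for a homomorphism `Φ` the form of the defect of `Φ Φ*` is `‖Φ*ξ‖² - ∑ ‖T_k*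
Φ*ξ‖²`, nonnegative because `(T_1, …, T_d)` is a row contraction.

Splitting `E` into coordinate lines, each placed inside `C`, turns one `Φ` into a sequence of
endomorphisms (`exists_hasSum_endomorphisms`). For an invariant subspace, `P T_k* = P T_k* P` makes
the defect of the projection positive, and the factor `Φ` obtained is automatically a partial
isometry. -/

theorem lp_separableSpace {ι : Type u} [Countable ι] (E : Type v) [NormedAddCommGroup E]
    [InnerProductSpace ℂ E] [TopologicalSpace.SeparableSpace E] :
    TopologicalSpace.SeparableSpace (lp (fun _ : ι => E) 2) := by
  classical
  let S : Set (lp (fun _ : ι => E) 2) :=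
    ⋃ i, Set.range (lp.singleContinuousLinearMap ℂ (fun _ : ι => E) 2 i)
  have hS : TopologicalSpace.IsSeparable S :=
    TopologicalSpace.IsSeparable.iUnion fun i =>
      TopologicalSpace.isSeparable_range
        (lp.singleContinuousLinearMap ℂ (fun _ : ι => E) 2 i).continuous
  have h := (hS.span (R := ℂ)).closure
  rw [← TopologicalSpace.isSeparable_univ_iff]
  refine h.mono fun f _ => ?_
  refine mem_closure_of_tendsto (lp.hasSum_single (by norm_num) f)
    (Filter.Eventually.of_forall fun s => ?_)
  exact Submodule.sum_mem _ fun i _ => Submodule.subset_span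
    (Set.mem_iUnion.2 ⟨i, f i, rfl⟩)

/-- Distinct orthonormal vectors are at distance `√2 > 1`, so balls of radius `1/2` about them are
disjoint open sets. -/
theorem Orthonormal.countable_index {H : Type u} [NormedAddCommGroup H] [InnerProductSpace ℂ H]
    [TopologicalSpace.SeparableSpace H] {ι : Type v} {b : ι → H} (hb : Orthonormal ℂ b) :
    Countable ι := by
  rw [← Set.countable_univ_iff]
  refine Set.PairwiseDisjoint.countable_of_isOpen
    (s := fun i => Metric.ball (b i) (1 / 2)) ?_ (fun i _ => Metric.isOpen_ball)
    (fun i _ => Metric.nonempty_ball.2 (by norm_num))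
  intro i _ j _ hij
  refine Metric.ball_disjoint_ball ?_
  have h1 : ‖b i - b j‖ ^ 2 = 2 := by
    rw [norm_sub_sq (𝕜 := ℂ), hb.2 hij, hb.1 i, hb.1 j]
    norm_num
  rw [dist_eq_norm]
  nlinarith [norm_nonneg (b i - b j)]

/-- The index type is free so that the target can be put in any prescribed universe. Only an
isometry can be expected, as `H` may be finite-dimensional. -/
theorem exists_linearIsometry_lp {H : Type u} [NormedAddCommGroup H] [InnerProductSpace ℂ H]
    [CompleteSpace H] [TopologicalSpace.SeparableSpace H] (ι : Type v) [Infinite ι] :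
    Nonempty (H →ₗᵢ[ℂ] lp (fun _ : ι => ℂ) 2) := by
  classical
  obtain ⟨w, b, -⟩ := exists_hilbertBasis ℂ H
  have : Countable w := b.orthonormal.countable_index
  obtain ⟨j, hj⟩ := exists_injective_nat w
  let e : w → ι := fun i => Infinite.natEmbedding ι (j i)
  have he : Function.Injective e := (Infinite.natEmbedding ι).injective.comp hj
  have ho : Orthonormal ℂ fun i => lp.single (E := fun _ : ι => ℂ) 2 (e i) (1 : ℂ) := by
    rw [orthonormal_iff_ite]
    intro i i'
    rw [lp.inner_single_left]
    by_cases h : i = i'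
    · subst h; simp
    · simp [h, lp.single_apply, he.ne h]
  exact ⟨ho.orthogonalFamily.linearIsometry.comp b.repr.toLinearIsometry⟩

/-! ### Words acting on free modules -/

section Words

variable {d : ℕ} {E : Type v} [NormedAddCommGroup E] [InnerProductSpace ℂ E] [CompleteSpace E]
  {C : Type u} [NormedAddCommGroup C] [InnerProductSpace ℂ C] [CompleteSpace C]

theorem isModuleHom_iff_coordMul {Φ : FreeModule d E →L[ℂ] FreeModule d C} :
    IsModuleHom Φ ↔ ∀ k, Φ ∘L coordMul k = coordMul k ∘L Φ := by
  constructor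
  · intro h k
    ext1 ξ
    simpa [polyRep_X] using h (MvPolynomial.X k) ξ
  · intro h f
    induction f using MvPolynomial.induction_on with
    | C a =>
      intro ξ
      rw [← MvPolynomial.algebraMap_eq, AlgHom.commutes, AlgHom.commutes,
        Algebra.algebraMap_eq_smul_one, Algebra.algebraMap_eq_smul_one]
      exact map_smul Φ a ξ
    | add p q hp hq => intro ξ; simp [hp, hq]
    | mul_X p k hp =>
      intro ξ
      have hk := congrArg (fun T => T ξ) (h k)
      simp only [ContinuousLinearMap.comp_apply] at hk
      simp [hp, polyRep_X, hk]

/-- Homomorphisms are handled through their adjoints because `T_k*` simply deletes a first letter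
from the coefficients, while `T_k` involves a projection. -/
theorem isModuleHom_adjoint_iff {L : FreeModule d C →L[ℂ] FreeModule d E} :
    IsModuleHom L.adjoint ↔
      ∀ k, L ∘L (coordMul k).adjoint = (coordMul k).adjoint ∘L L := by
  rw [isModuleHom_iff_coordMul]
  refine forall_congr' fun k => ?_
  rw [← ContinuousLinearMap.adjoint.injective.eq_iff]
  simp only [ContinuousLinearMap.adjoint_comp, ContinuousLinearMap.adjoint_adjoint]
  exact eq_comm

variable (d E) in
/-- The adjoint of multiplication by the monomial `z_w = z_{w 0} ⋯ z_{w (n-1)}`. -/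
def wordAdj {n : ℕ} (w : Fin n → Fin d) : FreeModule d E →L[ℂ] FreeModule d E :=
  (polyRep d E (∏ i, MvPolynomial.X (w i))).adjoint

theorem wordAdj_zero (w : Fin 0 → Fin d) : wordAdj d E w = 1 := by
  simp [wordAdj, ContinuousLinearMap.one_def, ContinuousLinearMap.adjoint_id]

theorem wordAdj_cons {n : ℕ} (k : Fin d) (w : Fin n → Fin d) (ξ : FreeModule d E) :
    wordAdj d E (Fin.cons k w : Fin (n + 1) → Fin d) ξ =
      wordAdj d E w ((coordMul k).adjoint ξ) := by
  rw [wordAdj, Fin.prod_univ_succ]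
  simp [wordAdj, polyRep_X, ContinuousLinearMap.mul_def, ContinuousLinearMap.adjoint_comp]

/-- As the multiplications commute, the letter can also be stripped last; the telescoping sum uses
this order. -/
theorem wordAdj_cons' {n : ℕ} (k : Fin d) (w : Fin n → Fin d) (ξ : FreeModule d E) :
    wordAdj d E (Fin.cons k w : Fin (n + 1) → Fin d) ξ =
      (coordMul k).adjoint (wordAdj d E w ξ) := by
  rw [wordAdj, Fin.prod_univ_succ, mul_comm]
  simp [wordAdj, polyRep_X, ContinuousLinearMap.mul_def, ContinuousLinearMap.adjoint_comp]

/-- This is what makes the family `R T_w* ξ` a symmetric tensor. -/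
theorem wordAdj_comp_perm {n : ℕ} (w : Fin n → Fin d) (τ : Equiv.Perm (Fin n)) :
    wordAdj d E (w ∘ τ) = wordAdj d E w := by
  simp only [wordAdj, Function.comp_apply]
  rw [Equiv.prod_comp τ fun i => (MvPolynomial.X (w i) : MvPolynomial (Fin d) ℂ)]

theorem sum_words_succ {M : Type*} [AddCommMonoid M] {n : ℕ} (f : (Fin (n + 1) → Fin d) → M) :
    ∑ w, f w = ∑ k, ∑ w : Fin n → Fin d, f (Fin.cons k w) := by
  rw [← (Fin.consEquiv fun _ => Fin d).sum_comp, Fintype.sum_prod_type]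
  rfl

theorem hasSum_finset_sum {ι : Type*} [Fintype ι] (f : ι → ℕ → ℝ) (a : ι → ℝ)
    (h : ∀ i, HasSum (f i) (a i)) : HasSum (fun m => ∑ i, f i m) (∑ i, a i) :=
  hasSum_sum fun i _ => h i

/-- The square norm of the homogeneous component of degree `n`. -/
def degreeNormSq (n : ℕ) (ξ : FreeModule d E) : ℝ :=
  ∑ w : Fin n → Fin d, ‖ξ.1 ⟨n, w⟩‖ ^ 2

theorem sum_degreeNormSq_adjoint (n : ℕ) (ξ : FreeModule d E) :
    ∑ k, degreeNormSq n ((coordMul k).adjoint ξ) = degreeNormSq (n + 1) ξ := by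
  rw [degreeNormSq, sum_words_succ]
  refine Finset.sum_congr rfl fun k _ => Finset.sum_congr rfl fun w _ => ?_
  rw [adjoint_coordMul_apply]
  rfl

omit [CompleteSpace E] in
theorem hasSum_degreeNormSq (ξ : FreeModule d E) :
    HasSum (fun n => degreeNormSq n ξ) (‖ξ‖ ^ 2) :=
  hasSum_norm_degree ξ.1

omit [CompleteSpace E] in
theorem degreeNormSq_nonneg (n : ℕ) (ξ : FreeModule d E) : 0 ≤ degreeNormSq n ξ :=
  Finset.sum_nonneg fun _ _ => sq_nonneg _

/-- `T_w*` strips the prefix `w`, so summing over all prefixes of length `n` counts each coefficient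
of degree at least `n` exactly once. -/
theorem hasSum_degreeNormSq_tail (n : ℕ) (ξ : FreeModule d E) :
    HasSum (fun m => degreeNormSq (m + n) ξ) (∑ w : Fin n → Fin d, ‖wordAdj d E w ξ‖ ^ 2) := by
  induction n generalizing ξ with
  | zero => simpa [wordAdj_zero] using hasSum_degreeNormSq ξ
  | succ n ih =>
    rw [sum_words_succ]
    simp only [wordAdj_cons]
    have h : HasSum (fun m => ∑ k, degreeNormSq (m + n) ((coordMul k).adjoint ξ))
        (∑ k, ∑ w : Fin n → Fin d, ‖wordAdj d E w ((coordMul k).adjoint ξ)‖ ^ 2) :=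
      hasSum_finset_sum _ _ fun k : Fin d => ih _
    simp only [sum_degreeNormSq_adjoint] at h
    exact h

theorem tendsto_sum_wordAdj (ξ : FreeModule d E) :
    Filter.Tendsto (fun n => ∑ w : Fin n → Fin d, ‖wordAdj d E w ξ‖ ^ 2) Filter.atTop
      (nhds 0) := by
  have h := tendsto_sum_nat_add fun n => degreeNormSq n ξ
  refine h.congr fun n => ?_
  exact (hasSum_degreeNormSq_tail n ξ).tsum_eq

/-- The row contraction property: the two sides differ by the degree zero part of `ξ`, since the
left one is the tail from degree `1`. -/
theorem sum_norm_adjoint_coordMul_le (ξ : FreeModule d E) :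
    ∑ k, ‖(coordMul k).adjoint ξ‖ ^ 2 ≤ ‖ξ‖ ^ 2 := by
  have h1 := hasSum_degreeNormSq_tail 1 ξ
  have h2 := (hasSum_nat_add_iff' 1).2 (hasSum_degreeNormSq ξ)
  have h3 := h1.unique h2
  rw [sum_words_succ] at h3
  simp only [wordAdj_cons, wordAdj_zero] at h3
  have h4 := degreeNormSq_nonneg 0 ξ
  simp only [Finset.univ_unique, Finset.sum_singleton, Finset.sum_range_one,
    one_apply_eq_self] at h3
  linarith

/-- `X - ∑_k T_k X T_k*`, where `T_k` is multiplication by `z_k`. -/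
def defect (X : FreeModule d E →L[ℂ] FreeModule d E) : FreeModule d E →L[ℂ] FreeModule d E :=
  X - ∑ k : Fin d, coordMul k ∘L X ∘L (coordMul k).adjoint

theorem inner_defect (X : FreeModule d E →L[ℂ] FreeModule d E) (ξ : FreeModule d E) :
    ⟪defect X ξ, ξ⟫_ℂ = ⟪X ξ, ξ⟫_ℂ -
      ∑ k, ⟪X ((coordMul k).adjoint ξ), (coordMul k).adjoint ξ⟫_ℂ := by
  simp only [defect, sub_apply, sum_apply,
    ContinuousLinearMap.comp_apply, inner_sub_left, sum_inner,
    ContinuousLinearMap.adjoint_inner_right]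

/-- Telescoping: applying `inner_defect` at `T_w* ξ` trades a word of length `N` for its `d`
extensions of length `N + 1`. -/
theorem sum_inner_defect_words (X : FreeModule d E →L[ℂ] FreeModule d E) (ξ : FreeModule d E)
    (N : ℕ) :
    ∑ n ∈ Finset.range N, ∑ w : Fin n → Fin d,
        ⟪defect X (wordAdj d E w ξ), wordAdj d E w ξ⟫_ℂ =
      ⟪X ξ, ξ⟫_ℂ - ∑ w : Fin N → Fin d, ⟪X (wordAdj d E w ξ), wordAdj d E w ξ⟫_ℂ := by
  induction N with
  | zero => simp [wordAdj_zero]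
  | succ N ih =>
    rw [Finset.sum_range_succ, ih, sum_words_succ, Finset.sum_comm]
    simp only [inner_defect, wordAdj_cons', Finset.sum_sub_distrib]
    ring

theorem tendsto_sum_inner_words (X : FreeModule d E →L[ℂ] FreeModule d E) (ξ : FreeModule d E) :
    Filter.Tendsto (fun n => ∑ w : Fin n → Fin d,
      ⟪X (wordAdj d E w ξ), wordAdj d E w ξ⟫_ℂ) Filter.atTop (nhds 0) := by
  have h := (tendsto_sum_wordAdj ξ).const_mul ‖X‖
  rw [mul_zero] at h
  refine squeeze_zero_norm (fun n => ?_) h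
  rw [Finset.mul_sum]
  refine (norm_sum_le _ _).trans (Finset.sum_le_sum fun w _ => ?_)
  refine (norm_inner_le_norm (𝕜 := ℂ) (X (wordAdj d E w ξ)) (wordAdj d E w ξ)).trans ?_
  rw [sq, ← mul_assoc]
  gcongr
  exact X.le_opNorm _

theorem tendsto_sum_inner_defect (X : FreeModule d E →L[ℂ] FreeModule d E) (ξ : FreeModule d E) :
    Filter.Tendsto (fun N => ∑ n ∈ Finset.range N, ∑ w : Fin n → Fin d,
        ⟪defect X (wordAdj d E w ξ), wordAdj d E w ξ⟫_ℂ) Filter.atTop (nhds ⟪X ξ, ξ⟫_ℂ) := by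
  simp only [sum_inner_defect_words]
  simpa using (tendsto_sum_inner_words X ξ).const_sub ⟪X ξ, ξ⟫_ℂ

end Words

/-! ### The inclusion of a free module in the Hardy space -/

section Inclusion

variable {d : ℕ} {C : Type u} [NormedAddCommGroup C] [InnerProductSpace ℂ C]

theorem homComponent_creation (k : Fin d) (n : ℕ) (f : FullFock d C) (z : UnitSphere d) :
    homComponent (n + 1) (creation k f) z = z.1 k • homComponent n f z := by
  change ∑ w : Fin (n + 1) → Fin d, (∏ i, z.1 (w i)) • creation k f ⟨n + 1, w⟩ =
    z.1 k • ∑ w : Fin n → Fin d, (∏ i, z.1 (w i)) • f ⟨n, w⟩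
  rw [sum_words_succ, Finset.sum_eq_single k]
  · rw [Finset.smul_sum]
    refine Finset.sum_congr rfl fun w _ => ?_
    rw [creation_apply, ← creationFun_consWord k f ⟨n, w⟩, consWord, Fin.prod_univ_succ, smul_smul]
    simp
  · intro j _ hj
    refine Finset.sum_eq_zero fun w _ => ?_
    simp [creation_apply, creationFun, hj]
  · simp

theorem homComponent_zero_creation (k : Fin d) (f : FullFock d C) (z : UnitSphere d) :
    homComponent 0 (creation k f) z = 0 := by
  change ∑ w : Fin 0 → Fin d, (∏ i, z.1 (w i)) • creation k f ⟨0, w⟩ = 0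
  simp [creation_apply, creationFun]

/-- The symmetric tensor whose inner product with `f` is `⟪c, homComponent n f z⟫`. -/
def evalTensor (n : ℕ) (z : UnitSphere d) (c : C) : FullFock d C :=
  ∑ w : Fin n → Fin d, lp.single (E := fun _ : Word d => C) 2 ⟨n, w⟩
    ((starRingEnd ℂ) (∏ i, z.1 (w i)) • c)

theorem evalTensor_mem (n : ℕ) (z : UnitSphere d) (c : C) :
    evalTensor n z c ∈ symTensors d C := by
  classical
  have key : ∀ v : Fin n → Fin d,
      (evalTensor n z c) ⟨n, v⟩ = (starRingEnd ℂ) (∏ i, z.1 (v i)) • c := by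
    intro v
    rw [evalTensor, lp.coeFn_sum, Finset.sum_apply, Finset.sum_eq_single v]
    · simp
    · intro w _ hw
      rw [lp.single_apply_ne]
      simpa using hw.symm
    · simp
  intro m τ v
  by_cases hm : m = n
  · subst hm
    rw [key, key]
    simp only [Function.comp_apply]
    rw [Equiv.prod_comp τ fun i => z.1 (v i)]
  · have : ∀ v : Fin m → Fin d, (evalTensor n z c) ⟨m, v⟩ = 0 := by
      intro v
      rw [evalTensor, lp.coeFn_sum, Finset.sum_apply]
      refine Finset.sum_eq_zero fun w _ => ?_
      rw [lp.single_apply_ne]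
      exact fun h => hm (congrArg Sigma.fst h)
    rw [this, this]

theorem inner_evalTensor (n : ℕ) (z : UnitSphere d) (c : C) (f : FullFock d C) :
    ⟪evalTensor n z c, f⟫_ℂ = ⟪c, homComponent n f z⟫_ℂ := by
  change _ = ⟪c, ∑ w : Fin n → Fin d, (∏ i, z.1 (w i)) • f ⟨n, w⟩⟫_ℂ
  rw [evalTensor, sum_inner, inner_sum]
  refine Finset.sum_congr rfl fun w _ => ?_
  rw [lp.inner_single_left, inner_smul_left, inner_smul_right, RingHomCompTriple.comp_apply,
    RingHom.id_apply]

variable [CompleteSpace C]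

/-- Evaluation at a point of the sphere is pairing with a symmetric tensor, so symmetrizing does not
change it. Hence the projection in `coordMul` is invisible on the sphere. -/
theorem homComponent_orthogonalProjection (n : ℕ) (f : FullFock d C) (z : UnitSphere d) :
    homComponent n ((symTensors d C).orthogonalProjectionOnto f : FullFock d C) z =
      homComponent n f z := by
  refine ext_inner_left ℂ fun c => ?_
  rw [← inner_evalTensor, ← inner_evalTensor]
  exact Submodule.inner_orthogonalProjectionOnto_eq_of_mem_left ⟨_, evalTensor_mem n z c⟩ f

theorem homLp_succ_coordMul (k : Fin d) (n : ℕ) (ξ : FreeModule d C) :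
    homLp (n + 1) (coordMul k ξ).1 = coordMulL2 d C k (homLp n ξ.1) := by
  refine Lp.ext ?_
  filter_upwards [coordMulL2_coe d C k (homLp n ξ.1),
    ContinuousMap.coeFn_toLp (p := 2) (𝕜 := ℂ) (sphereMeasure d) (homComponent n ξ.1),
    ContinuousMap.coeFn_toLp (p := 2) (𝕜 := ℂ) (sphereMeasure d)
      (homComponent (n + 1) (coordMul k ξ).1)] with z h1 h2 h3
  rw [h1]
  refine h3.trans ?_
  refine Eq.trans ?_ (congrArg (fun x => z.1 k • x) h2).symm
  rw [← homComponent_creation]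
  exact homComponent_orthogonalProjection _ _ z

theorem homLp_zero_coordMul (k : Fin d) (ξ : FreeModule d C) :
    homLp 0 (coordMul k ξ).1 = 0 := by
  have h : homComponent 0 (coordMul k ξ).1 = 0 := by
    ext z
    exact (homComponent_orthogonalProjection _ _ z).trans (homComponent_zero_creation k _ z)
  change sphereToLp d C (homComponent 0 (coordMul k ξ).1) = 0
  rw [h, map_zero]

theorem hasSum_inclusion (ξ : FreeModule d C) :
    HasSum (fun n => homLp n ξ.1) (inclusion d C ξ : Lp C 2 (sphereMeasure d)) :=
  (summable_homLp ξ.1).hasSum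

theorem inclusion_coordMul (k : Fin d) :
    inclusion d C ∘L coordMul k = hardyMul d C k ∘L inclusion d C := by
  ext1 ξ
  apply Subtype.ext
  have h1 := hasSum_inclusion (coordMul k ξ)
  have h2 := (hasSum_inclusion ξ).mapL (coordMulL2 d C k)
  -- Multiplication by `z_k` raises the degree by one, so the series for `b (T_k ξ)` is reindexed
  -- after dropping its vanishing degree zero term.
  rw [← hasSum_nat_add_iff' 1] at h1
  simp only [homLp_succ_coordMul, Finset.sum_range_one, homLp_zero_coordMul, sub_zero] at h1
  exact h1.unique h2

/-- Components of different degrees are orthogonal in `L²`, so pairing with one component isolates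
it. -/
theorem homLp_eq_zero_of_inclusion {ξ : FreeModule d C} (h : inclusion d C ξ = 0) (n : ℕ) :
    homLp n ξ.1 = 0 := by
  have h1 := (hasSum_inclusion ξ).mapL (innerSL ℂ (homLp n ξ.1))
  rw [h] at h1
  have h2 : HasSum (fun m => innerSL ℂ (homLp n ξ.1) (homLp m ξ.1))
      (innerSL ℂ (homLp n ξ.1) (homLp n ξ.1)) := by
    refine hasSum_single n fun m hm => ?_
    exact inner_homLp_of_ne hm.symm _ _
  have h3 := h2.unique h1
  simpa using h3

end Inclusion

/-! ### Injectivity of the inclusion and transfer of positivity -/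

theorem exists_perm_of_card_fiber_eq {ι κ : Type*} [Fintype ι] [DecidableEq κ] {v w : ι → κ}
    (h : ∀ k, Fintype.card {i // v i = k} = Fintype.card {i // w i = k}) :
    ∃ τ : Equiv.Perm ι, v = w ∘ τ := by
  refine ⟨Equiv.ofFiberEquiv fun k => Fintype.equivOfCardEq (h k), ?_⟩
  funext i
  exact (Equiv.ofFiberEquiv_map _ i).symm

theorem exists_perm_of_sum_single_eq {n d : ℕ} {v w : Fin n → Fin d}
    (h : ∑ i, Finsupp.single (v i) 1 = ∑ i, (Finsupp.single (w i) 1 : Fin d →₀ ℕ)) :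
    ∃ τ : Equiv.Perm (Fin n), v = w ∘ τ := by
  refine exists_perm_of_card_fiber_eq fun k => ?_
  have h1 := DFunLike.congr_fun h k
  simpa [Finsupp.finsetSum_apply, Finsupp.single_apply, Fintype.card_subtype] using h1

/-- A symmetric family of coefficients is determined by the polynomial it defines. -/
theorem eq_zero_of_sum_words_eq_zero {n d : ℕ} {a : (Fin n → Fin d) → ℂ}
    (ha : ∀ (τ : Equiv.Perm (Fin n)) w, a (w ∘ τ) = a w)
    (h : ∀ x : Fin d → ℂ, ∑ w : Fin n → Fin d, (∏ i, x (w i)) * a w = 0) : a = 0 := by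
  classical
  let p : MvPolynomial (Fin d) ℂ :=
    ∑ w : Fin n → Fin d, MvPolynomial.monomial (∑ i, Finsupp.single (w i) 1) (a w)
  have hp : p = 0 := by
    refine MvPolynomial.funext fun x => ?_
    rw [map_zero, ← h x, map_sum]
    refine Finset.sum_congr rfl fun w _ => ?_
    have : (MvPolynomial.monomial (∑ i, Finsupp.single (w i) 1) (a w) :
        MvPolynomial (Fin d) ℂ) = MvPolynomial.C (a w) * ∏ i, MvPolynomial.X (w i) := by
      rw [← mul_one (a w), ← MvPolynomial.C_mul_monomial, MvPolynomial.monomial_sum_one, mul_one]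
      rfl
    rw [this]
    simp [map_prod, mul_comm]
  -- Words with the same monomial are rearrangements of each other, so this coefficient of `p` is `a
  -- v` times the number of rearrangements of `v`, a nonzero integer.
  funext v
  have h1 := congrArg (MvPolynomial.coeff (∑ i, Finsupp.single (v i) 1)) hp
  rw [MvPolynomial.coeff_sum] at h1
  simp only [MvPolynomial.coeff_monomial, MvPolynomial.coeff_zero] at h1
  have h2 : ∀ w : Fin n → Fin d, (if (∑ i, Finsupp.single (w i) 1 : Fin d →₀ ℕ) =
      ∑ i, Finsupp.single (v i) 1 then a w else 0) =
      (if (∑ i, Finsupp.single (w i) 1 : Fin d →₀ ℕ) = ∑ i, Finsupp.single (v i) 1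
        then 1 else 0) * a v := by
    intro w
    split_ifs with hw
    · obtain ⟨τ, rfl⟩ := exists_perm_of_sum_single_eq hw
      rw [ha, one_mul]
    · simp
  simp only [h2] at h1
  rw [← Finset.sum_mul, Finset.sum_boole] at h1
  refine (mul_eq_zero.1 h1).resolve_left ?_
  refine Nat.cast_ne_zero.2 ?_
  exact Finset.card_ne_zero.2 ⟨v, by simp⟩

/-- Needed so that a continuous function vanishing almost everywhere on the sphere vanishes
identically. -/
theorem sphereMeasure_isOpenPosMeasure (d : ℕ) : (sphereMeasure d).IsOpenPosMeasure := by
  constructor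
  intro U hU hne
  rw [sphereMeasure, Measure.smul_apply, smul_eq_mul]
  refine mul_ne_zero ?_ (hU.measure_ne_zero _ hne)
  rw [ENNReal.inv_ne_zero]
  exact measure_ne_top _ _

section Injective

variable {d : ℕ} {C : Type u} [NormedAddCommGroup C] [InnerProductSpace ℂ C] [CompleteSpace C]

-- Homogeneity spreads the vanishing from the sphere to all of `ℂ^d`; pairing with vectors of `C`
-- reduces to scalar polynomials.
omit [CompleteSpace C] in
theorem eq_zero_of_homComponent_eq_zero (hd : 1 ≤ d) {ξ : FreeModule d C}
    (h : ∀ n, homComponent n ξ.1 = 0) : ξ = 0 := by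
  ext ⟨n, w⟩
  refine ext_inner_left ℂ fun c => ?_
  have key := eq_zero_of_sum_words_eq_zero (a := fun w : Fin n → Fin d => ⟪c, ξ.1 ⟨n, w⟩⟫_ℂ)
    (fun τ w => by rw [ξ.2 n τ w]) ?_
  · simpa using congrFun key w
  have hsphere : ∀ z : UnitSphere d, ∑ w : Fin n → Fin d,
      (∏ i, z.1 (w i)) * ⟪c, ξ.1 ⟨n, w⟩⟫_ℂ = 0 := by
    intro z
    have h1 : ∑ w : Fin n → Fin d, (∏ i, z.1 (w i)) • ξ.1 ⟨n, w⟩ = 0 :=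
      DFunLike.congr_fun (h n) z
    have h2 := congrArg (fun x => ⟪c, x⟫_ℂ) h1
    simpa [inner_sum, inner_smul_right] using h2
  have hscale : ∀ (r : ℂ) (z : UnitSphere d), ∑ w : Fin n → Fin d,
      (∏ i, (r * z.1 (w i))) * ⟪c, ξ.1 ⟨n, w⟩⟫_ℂ = 0 := by
    intro r z
    simp only [Finset.prod_mul_distrib, mul_assoc, Finset.prod_const]
    rw [← Finset.mul_sum, hsphere, mul_zero]
  intro x
  let y : EuclideanSpace ℂ (Fin d) := WithLp.toLp 2 x
  -- The origin is reached with scale `0` from any point of the sphere; `1 ≤ d` supplies such a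
  -- point. This also covers `n = 0`, where the product is empty.
  by_cases hy : y = 0
  · let z : UnitSphere d := ⟨EuclideanSpace.single ⟨0, hd⟩ 1, by simp⟩
    have hx : x = 0 := by
      funext i
      exact congrArg (fun v : EuclideanSpace ℂ (Fin d) => v i) hy
    simpa [hx] using hscale 0 z
  · have hn : (‖y‖ : ℂ) ≠ 0 := by simpa using hy
    let z : UnitSphere d := ⟨(‖y‖ : ℂ)⁻¹ • y, by simp [norm_smul, hy]⟩
    have hz : ∀ i, (‖y‖ : ℂ) * z.1 i = x i := by
      intro i
      simp [z, y, mul_inv_cancel_left₀ hn]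
    simpa only [hz] using hscale ‖y‖ z

theorem inclusion_injective (hd : 1 ≤ d) : Function.Injective (inclusion d C) := by
  rw [injective_iff_map_eq_zero]
  intro ξ h
  have := sphereMeasure_isOpenPosMeasure d
  refine eq_zero_of_homComponent_eq_zero hd fun n => ?_
  refine ContinuousMap.toLp_injective (p := 2) (𝕜 := ℂ) (sphereMeasure d) ?_
  rw [map_zero]
  exact homLp_eq_zero_of_inclusion h n

theorem conj_comp_of_intertwine {H : Type u} {K : Type v} [NormedAddCommGroup H]
    [InnerProductSpace ℂ H] [CompleteSpace H] [NormedAddCommGroup K] [InnerProductSpace ℂ K]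
    [CompleteSpace K] {b : H →L[ℂ] K} {T : H →L[ℂ] H} {Z : K →L[ℂ] K}
    (h : b ∘L T = Z ∘L b) (X : H →L[ℂ] H) :
    Z ∘L (b ∘L X ∘L b.adjoint) ∘L Z.adjoint = b ∘L (T ∘L X ∘L T.adjoint) ∘L b.adjoint := by
  have h2 : b.adjoint ∘L Z.adjoint = T.adjoint ∘L b.adjoint := by
    rw [← ContinuousLinearMap.adjoint_comp, ← ContinuousLinearMap.adjoint_comp, h]
  calc Z ∘L (b ∘L X ∘L b.adjoint) ∘L Z.adjoint =
      (Z ∘L b) ∘L X ∘L (b.adjoint ∘L Z.adjoint) := rfl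
    _ = _ := by rw [h2, ← h]; rfl

theorem conj_sub_sum_of_intertwine {H : Type u} {K : Type v} [NormedAddCommGroup H]
    [InnerProductSpace ℂ H] [CompleteSpace H] [NormedAddCommGroup K] [InnerProductSpace ℂ K]
    [CompleteSpace K] {ι : Type*} [Fintype ι] {b : H →L[ℂ] K} {T : ι → H →L[ℂ] H}
    {Z : ι → K →L[ℂ] K} (h : ∀ k, b ∘L T k = Z k ∘L b) (X : H →L[ℂ] H) :
    b ∘L X ∘L b.adjoint - ∑ k, Z k ∘L (b ∘L X ∘L b.adjoint) ∘L (Z k).adjoint =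
      b ∘L (X - ∑ k, T k ∘L X ∘L (T k).adjoint) ∘L b.adjoint := by
  rw [Finset.sum_congr rfl fun k _ => conj_comp_of_intertwine (h k) X]
  ext1 f
  simp [map_sum]

theorem dGamma_eq (X : FreeModule d C →L[ℂ] FreeModule d C) :
    dGamma X = inclusion d C ∘L defect X ∘L (inclusion d C).adjoint :=
  conj_sub_sum_of_intertwine inclusion_coordMul X

theorem dense_range_adjoint_inclusion (hd : 1 ≤ d) :
    DenseRange (inclusion d C).adjoint := by
  have h := ContinuousLinearMap.orthogonal_ker (inclusion d C)
  have hk : (inclusion d C).ker = ⊥ := LinearMap.ker_eq_bot.2 (inclusion_injective hd)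
  rw [hk, Submodule.bot_orthogonal_eq_top] at h
  intro ξ
  have : ξ ∈ ((inclusion d C).adjoint.range).topologicalClosure := by
    rw [← h]; trivial
  exact this

/-- The form of `b D b*` at `f` is that of `D` at `b* f`. Being real and nonnegative is a closed
condition, so it passes from the dense range of `b*` to every vector. -/
theorem isPositive_dGamma_iff (hd : 1 ≤ d) (X : FreeModule d C →L[ℂ] FreeModule d C) :
    (dGamma X).IsPositive ↔ (defect X).IsPositive := by
  rw [dGamma_eq]
  refine ⟨fun h => ?_, fun h => h.conj_adjoint (inclusion d C)⟩
  rw [ContinuousLinearMap.isPositive_iff_complex] at h ⊢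
  intro ξ
  have hc : Continuous fun ξ => ⟪defect X ξ, ξ⟫_ℂ := (defect X).continuous.inner continuous_id
  have hr := RCLike.continuous_re.comp hc
  refine (dense_range_adjoint_inclusion hd).induction_on
    (p := fun ξ => (RCLike.re ⟪defect X ξ, ξ⟫_ℂ : ℂ) = ⟪defect X ξ, ξ⟫_ℂ ∧
      0 ≤ RCLike.re ⟪defect X ξ, ξ⟫_ℂ) ξ ?_ fun f => ?_
  · exact (isClosed_eq (Complex.continuous_ofReal.comp hr) hc).inter
      (isClosed_le continuous_const hr)
  · have hf := h f
    simp only [ContinuousLinearMap.comp_apply] at hf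
    rwa [← ContinuousLinearMap.adjoint_inner_right] at hf

end Injective

/-! ### Factorization -/

/-- `R` is the positive square root of `D` followed by an isometric embedding into `ℓ²(ι)`. -/
theorem exists_adjoint_comp_eq {H : Type u} [NormedAddCommGroup H] [InnerProductSpace ℂ H]
    [CompleteSpace H] [TopologicalSpace.SeparableSpace H] {D : H →L[ℂ] H} (hD : D.IsPositive)
    (ι : Type v) [Infinite ι] :
    ∃ R : H →L[ℂ] lp (fun _ : ι => ℂ) 2, D = R.adjoint ∘L R := by
  obtain ⟨V⟩ := exists_linearIsometry_lp (H := H) ι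
  have h0 : 0 ≤ D := (ContinuousLinearMap.nonneg_iff_isPositive D).2 hD
  have h1 : CFC.sqrt D * CFC.sqrt D = D := CFC.sqrt_mul_sqrt_self D h0
  have h2 : (CFC.sqrt D).adjoint = CFC.sqrt D :=
    ((ContinuousLinearMap.nonneg_iff_isPositive _).1 (CFC.sqrt_nonneg D)).isSelfAdjoint
  refine ⟨V.toContinuousLinearMap ∘L CFC.sqrt D, ?_⟩
  have h3 : V.toContinuousLinearMap.adjoint ∘L V.toContinuousLinearMap = 1 :=
    (ContinuousLinearMap.norm_map_iff_adjoint_comp_self _).1 V.norm_map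
  rw [ContinuousLinearMap.adjoint_comp, ContinuousLinearMap.comp_assoc,
    ← ContinuousLinearMap.comp_assoc _ _ (CFC.sqrt D), h3, h2]
  exact h1.symm

section Factorization

variable {d : ℕ} {E : Type v} [NormedAddCommGroup E] [InnerProductSpace ℂ E] [CompleteSpace E]
  {C : Type u} [NormedAddCommGroup C] [InnerProductSpace ℂ C] [CompleteSpace C]

/-- The family of the vectors `R T_w* ξ`, where `T_w` is multiplication by `z_w`. -/
def orbitFun (R : FreeModule d C →L[ℂ] E) (ξ : FreeModule d C) : Word d → E :=
  fun w => R (wordAdj d C w.2 ξ)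

theorem hasSum_orbitFun {X : FreeModule d C →L[ℂ] FreeModule d C} {R : FreeModule d C →L[ℂ] E}
    (h : defect X = R.adjoint ∘L R) (ξ : FreeModule d C) :
    HasSum (fun w => ‖orbitFun R ξ w‖ ^ 2) (RCLike.re ⟪X ξ, ξ⟫_ℂ) := by
  have h1 := (RCLike.continuous_re.tendsto _).comp (tendsto_sum_inner_defect X ξ)
  have h2 : ∀ η, RCLike.re ⟪defect X η, η⟫_ℂ = ‖R η‖ ^ 2 := by
    intro η
    rw [h, ContinuousLinearMap.comp_apply, ContinuousLinearMap.adjoint_inner_left,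
      inner_self_eq_norm_sq]
  have h3 : HasSum (fun n => ∑ w : Fin n → Fin d, ‖orbitFun R ξ ⟨n, w⟩‖ ^ 2)
      (RCLike.re ⟪X ξ, ξ⟫_ℂ) := by
    rw [hasSum_iff_tendsto_nat_of_nonneg fun n => Finset.sum_nonneg fun _ _ => sq_nonneg _]
    refine h1.congr fun N => ?_
    simp only [Function.comp_apply, map_sum, h2]
    rfl
  -- The limit was obtained length by length; nonnegativity of the terms permits regrouping into one
  -- sum over words.
  have h4 : Summable fun w => ‖orbitFun R ξ w‖ ^ 2 := by
    rw [summable_sigma_of_nonneg fun _ => sq_nonneg _]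
    refine ⟨fun n => (hasSum_fintype _).summable, ?_⟩
    simpa only [tsum_fintype] using h3.summable
  have h5 := h4.hasSum.sigma fun n => hasSum_fintype _
  rw [← h5.unique h3]
  exact h4.hasSum

theorem orbitFun_mem {X : FreeModule d C →L[ℂ] FreeModule d C} {R : FreeModule d C →L[ℂ] E}
    (h : defect X = R.adjoint ∘L R) (ξ : FreeModule d C) :
    Memℓp (E := fun _ : Word d => E) (orbitFun R ξ) 2 := by
  rw [memℓp_gen_iff (by norm_num)]
  simpa using (hasSum_orbitFun h ξ).summable

/-- The operator `ξ ↦ ∑_w e_w ⊗ R T_w* ξ`. -/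
def orbitMap {X : FreeModule d C →L[ℂ] FreeModule d C} {R : FreeModule d C →L[ℂ] E}
    (h : defect X = R.adjoint ∘L R) : FreeModule d C →L[ℂ] FreeModule d E :=
  LinearMap.mkContinuous
    { toFun := fun ξ => ⟨⟨orbitFun R ξ, orbitFun_mem h ξ⟩, fun n τ w =>
        congrArg (fun T => R (T ξ)) (wordAdj_comp_perm w τ)⟩
      map_add' := by
        intro ξ η
        ext w
        exact (congrArg R (map_add _ ξ η)).trans (map_add _ _ _)
      map_smul' := by
        intro c ξ
        ext w
        exact (congrArg R (map_smul _ c ξ)).trans (map_smul _ _ _) }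
    -- The squared norm of the image is `⟪Xξ, ξ⟫ ≤ ‖X‖ ‖ξ‖²`.
    √‖X‖ (by
      intro ξ
      refine (sq_le_sq₀ (norm_nonneg _) (by positivity)).1 ?_
      refine le_trans ?_ (le_of_eq (by rw [mul_pow, Real.sq_sqrt (norm_nonneg X)] :
        ‖X‖ * ‖ξ‖ ^ 2 = (√‖X‖ * ‖ξ‖) ^ 2))
      refine (norm_sq_eq_tsum (E := E) (d := d) ⟨orbitFun R ξ, orbitFun_mem h ξ⟩).le.trans ?_
      refine (hasSum_orbitFun h ξ).tsum_eq.le.trans ?_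
      refine (RCLike.re_le_norm _).trans ((norm_inner_le_norm (X ξ) ξ).trans ?_)
      rw [sq, ← mul_assoc]
      gcongr
      exact X.le_opNorm _)

theorem orbitMap_apply {X : FreeModule d C →L[ℂ] FreeModule d C} {R : FreeModule d C →L[ℂ] E}
    (h : defect X = R.adjoint ∘L R) (ξ : FreeModule d C) (w : Word d) :
    (orbitMap h ξ).1 w = R (wordAdj d C w.2 ξ) := rfl

theorem norm_orbitMap_sq {X : FreeModule d C →L[ℂ] FreeModule d C} {R : FreeModule d C →L[ℂ] E}
    (h : defect X = R.adjoint ∘L R) (ξ : FreeModule d C) :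
    ‖orbitMap h ξ‖ ^ 2 = RCLike.re ⟪X ξ, ξ⟫_ℂ :=
  (norm_sq_eq_tsum (orbitMap h ξ).1).trans (hasSum_orbitFun h ξ).tsum_eq

theorem isModuleHom_adjoint_orbitMap {X : FreeModule d C →L[ℂ] FreeModule d C}
    {R : FreeModule d C →L[ℂ] E} (h : defect X = R.adjoint ∘L R) :
    IsModuleHom (orbitMap h).adjoint := by
  rw [isModuleHom_adjoint_iff]
  intro k
  ext ξ w
  simp only [ContinuousLinearMap.comp_apply]
  rw [adjoint_coordMul_apply, orbitMap_apply, orbitMap_apply]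
  exact congrArg R (wordAdj_cons k w.2 ξ).symm

/-- `X` is not assumed self-adjoint: its form is real as a limit of sums of values of the form of
the defect. -/
theorem inner_eq_ofReal_re_of_isPositive_defect {X : FreeModule d C →L[ℂ] FreeModule d C}
    (h : (defect X).IsPositive) (ξ : FreeModule d C) :
    ⟪X ξ, ξ⟫_ℂ = (RCLike.re ⟪X ξ, ξ⟫_ℂ : ℂ) := by
  have hc : IsClosed {z : ℂ | z = (RCLike.re z : ℂ)} :=
    isClosed_eq continuous_id (Complex.continuous_ofReal.comp RCLike.continuous_re)
  refine hc.mem_of_tendsto (tendsto_sum_inner_defect X ξ) (Filter.Eventually.of_forall fun N => ?_)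
  have h1 := fun η => ((ContinuousLinearMap.isPositive_iff_complex _).1 h η).1
  change _ = _
  simp only [map_sum, Complex.ofReal_sum]
  exact Finset.sum_congr rfl fun n _ => Finset.sum_congr rfl fun w _ => (h1 _).symm

/-- Both quadratic forms agree, and over `ℂ` polarization recovers the operator. -/
theorem adjoint_orbitMap_comp {X : FreeModule d C →L[ℂ] FreeModule d C}
    {R : FreeModule d C →L[ℂ] E} (h : defect X = R.adjoint ∘L R) :
    (orbitMap h).adjoint ∘L orbitMap h = X := by
  apply ContinuousLinearMap.coe_injective
  rw [← ext_inner_map]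
  intro ξ
  have hpos : (defect X).IsPositive := by
    rw [h]
    exact ContinuousLinearMap.isPositive_adjoint_comp_self R
  change ⟪(orbitMap h).adjoint (orbitMap h ξ), ξ⟫_ℂ = ⟪X ξ, ξ⟫_ℂ
  rw [ContinuousLinearMap.adjoint_inner_left, inner_eq_ofReal_re_of_isPositive_defect hpos, ← norm_orbitMap_sq h,
    inner_self_eq_norm_sq_to_K]
  simp

theorem exists_factorization [TopologicalSpace.SeparableSpace C]
    {X : FreeModule d C →L[ℂ] FreeModule d C} (hX : (defect X).IsPositive) (ι : Type v)
    [Infinite ι] :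
    ∃ Φ : FreeModule d (lp (fun _ : ι => ℂ) 2) →L[ℂ] FreeModule d C,
      IsModuleHom Φ ∧ X = Φ ∘L Φ.adjoint := by
  have : TopologicalSpace.SeparableSpace (FullFock d C) := lp_separableSpace C
  have : TopologicalSpace.SeparableSpace (FreeModule d C) := inferInstance
  obtain ⟨R, hR⟩ := exists_adjoint_comp_eq hX ι
  refine ⟨(orbitMap hR).adjoint, isModuleHom_adjoint_orbitMap hR, ?_⟩
  rw [ContinuousLinearMap.adjoint_adjoint, adjoint_orbitMap_comp]

theorem re_inner_defect_comp_adjoint_nonneg {Φ : FreeModule d E →L[ℂ] FreeModule d C}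
    (hΦ : IsModuleHom Φ) (ξ : FreeModule d C) :
    0 ≤ RCLike.re ⟪defect (Φ ∘L Φ.adjoint) ξ, ξ⟫_ℂ := by
  have h : ∀ k, Φ.adjoint ((coordMul k).adjoint ξ) = (coordMul k).adjoint (Φ.adjoint ξ) := by
    have h0 := isModuleHom_adjoint_iff.1 (Φ.adjoint_adjoint.symm ▸ hΦ)
    exact fun k => DFunLike.congr_fun (h0 k) ξ
  have h2 : ∀ η, ⟪(Φ ∘L Φ.adjoint) η, η⟫_ℂ = (‖Φ.adjoint η‖ ^ 2 : ℝ) := by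
    intro η
    rw [ContinuousLinearMap.comp_apply, ← ContinuousLinearMap.adjoint_inner_right,
      inner_self_eq_norm_sq_to_K]
    simp
  rw [inner_defect]
  simp only [h2, h]
  rw [← Complex.ofReal_sum, ← Complex.ofReal_sub]
  exact sub_nonneg.2 (sum_norm_adjoint_coordMul_le (Φ.adjoint ξ))

theorem isSelfAdjoint_defect {X : FreeModule d C →L[ℂ] FreeModule d C} (hX : IsSelfAdjoint X) :
    IsSelfAdjoint (defect X) :=
  hX.sub (isSelfAdjoint_sum _ fun k _ => hX.conj_adjoint (coordMul k))

theorem isPositive_defect_comp_adjoint {Φ : FreeModule d E →L[ℂ] FreeModule d C}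
    (hΦ : IsModuleHom Φ) : (defect (Φ ∘L Φ.adjoint)).IsPositive :=
  ContinuousLinearMap.isPositive_def'.2
    ⟨isSelfAdjoint_defect (ContinuousLinearMap.isPositive_self_comp_adjoint Φ).isSelfAdjoint,
      re_inner_defect_comp_adjoint_nonneg hΦ⟩

/-- Strong convergence suffices: `T_k` on the left is continuous, and `T_k*` on the right only
changes the vector of evaluation. -/
theorem hasSum_defect {ι : Type*} {Y : ι → FreeModule d C →L[ℂ] FreeModule d C}
    {X : FreeModule d C →L[ℂ] FreeModule d C} (h : ∀ ξ, HasSum (fun n => Y n ξ) (X ξ))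
    (ξ : FreeModule d C) : HasSum (fun n => defect (Y n) ξ) (defect X ξ) := by
  have h1 : ∀ k : Fin d, HasSum (fun n => coordMul k (Y n ((coordMul k).adjoint ξ)))
      (coordMul k (X ((coordMul k).adjoint ξ))) := fun k => (h _).mapL (coordMul k)
  simp only [defect, sub_apply, sum_apply, ContinuousLinearMap.comp_apply]
  exact (h ξ).sub (hasSum_sum fun k _ => h1 k)

theorem isPositive_of_hasSum {H : Type u} [NormedAddCommGroup H] [InnerProductSpace ℂ H]
    {ι : Type*} {Y : ι → H →L[ℂ] H} {X : H →L[ℂ] H} (h : ∀ ξ, HasSum (fun n => Y n ξ) (X ξ))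
    (hY : ∀ n, (Y n).IsPositive) : X.IsPositive := by
  rw [ContinuousLinearMap.isPositive_iff_complex]
  intro ξ
  have h1 : HasSum (fun n => ⟪ξ, Y n ξ⟫_ℂ) ⟪ξ, X ξ⟫_ℂ := (h ξ).mapL (innerSL ℂ ξ)
  have h2 : HasSum (fun n => ⟪Y n ξ, ξ⟫_ℂ) ⟪X ξ, ξ⟫_ℂ := by
    have := h1.star
    simpa using this
  have h3 := h2.mapL Complex.reCLM
  have h4 := h3.mapL Complex.ofRealCLM
  have hp := fun n => (ContinuousLinearMap.isPositive_iff_complex _).1 (hY n) ξ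
  refine ⟨?_, h3.nonneg fun n => (hp n).2⟩
  have h5 : (fun n => Complex.ofRealCLM (Complex.reCLM ⟪Y n ξ, ξ⟫_ℂ)) =
      fun n => ⟪Y n ξ, ξ⟫_ℂ := funext fun n => (hp n).1
  rw [h5] at h4
  exact h4.unique h2

end Factorization

/-! ### Amplification -/

section Amplification

variable {d : ℕ} {E : Type v} [NormedAddCommGroup E] [InnerProductSpace ℂ E] [CompleteSpace E]
  {C : Type u} [NormedAddCommGroup C] [InnerProductSpace ℂ C] [CompleteSpace C]

omit [CompleteSpace E] [CompleteSpace C] in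
theorem memℓp_comp_coeff (T : E →L[ℂ] C) (ξ : FreeModule d E) :
    Memℓp (E := fun _ : Word d => C) (fun w => T (ξ.1 w)) 2 := by
  rw [memℓp_gen_iff (by norm_num)]
  have h : Summable fun w => ‖T (ξ.1 w)‖ ^ 2 := by
    refine Summable.of_nonneg_of_le (fun w => sq_nonneg _) (fun w => ?_)
      ((summable_norm_sq ξ.1).mul_left (‖T‖ ^ 2))
    rw [← mul_pow]
    gcongr
    exact T.le_opNorm _
  simpa using h

variable (d) in
/-- The operator `1 ⊗ T` on free modules. -/
def amplify (T : E →L[ℂ] C) : FreeModule d E →L[ℂ] FreeModule d C :=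
  LinearMap.mkContinuous
    { toFun := fun ξ => ⟨⟨fun w => T (ξ.1 w), memℓp_comp_coeff T ξ⟩, fun n τ w =>
        congrArg T (ξ.2 n τ w)⟩
      map_add' := by
        intro ξ η
        ext w
        exact map_add T _ _
      map_smul' := by
        intro c ξ
        ext w
        exact map_smul T c _ }
    ‖T‖ (by
      intro ξ
      refine (sq_le_sq₀ (norm_nonneg _) (by positivity)).1 ?_
      refine (norm_sq_eq_tsum (E := C) (d := d) ⟨_, memℓp_comp_coeff T ξ⟩).le.trans ?_
      refine le_trans ?_ (le_of_eq (by rw [mul_pow] : ‖T‖ ^ 2 * ‖ξ‖ ^ 2 = (‖T‖ * ‖ξ‖) ^ 2))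
      have h1 : ‖ξ‖ ^ 2 = ∑' w, ‖ξ.1 w‖ ^ 2 := norm_sq_eq_tsum ξ.1
      rw [h1, ← tsum_mul_left]
      have h2 := memℓp_comp_coeff T ξ
      rw [memℓp_gen_iff (by norm_num)] at h2
      refine Summable.tsum_le_tsum (fun w => ?_) (by simpa using h2)
        ((summable_norm_sq ξ.1).mul_left _)
      rw [← mul_pow]
      gcongr
      exact T.le_opNorm _)

omit [CompleteSpace E] [CompleteSpace C] in
theorem amplify_apply (T : E →L[ℂ] C) (ξ : FreeModule d E) (w : Word d) :
    (amplify d T ξ).1 w = T (ξ.1 w) := rfl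

theorem isModuleHom_adjoint_amplify (T : E →L[ℂ] C) : IsModuleHom (amplify d T).adjoint := by
  rw [isModuleHom_adjoint_iff]
  intro k
  ext ξ w
  simp only [ContinuousLinearMap.comp_apply]
  rw [adjoint_coordMul_apply, amplify_apply, amplify_apply, adjoint_coordMul_apply]

theorem adjoint_amplify (T : E →L[ℂ] C) : (amplify d T).adjoint = amplify d T.adjoint := by
  symm
  rw [ContinuousLinearMap.eq_adjoint_iff]
  intro η ξ
  rw [Submodule.coe_inner, Submodule.coe_inner, lp.inner_eq_tsum, lp.inner_eq_tsum]
  refine tsum_congr fun w => ?_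
  rw [amplify_apply, amplify_apply, ContinuousLinearMap.adjoint_inner_left]

-- Dominated convergence over words; `hb` bounds the error at `w` by `‖ξ w‖`, uniformly in the
-- finite set.
omit [CompleteSpace E] in
theorem hasSum_amplify {ι : Type*} {P : ι → E →L[ℂ] E} (h : ∀ x, HasSum (fun n => P n x) x)
    (hb : ∀ (s : Finset ι) x, ‖x - ∑ n ∈ s, P n x‖ ≤ ‖x‖) (ξ : FreeModule d E) :
    HasSum (fun n => amplify d (P n) ξ) ξ := by
  have key : ∀ s : Finset ι, ‖ξ - ∑ n ∈ s, amplify d (P n) ξ‖ ^ 2 =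
      ∑' w, ‖ξ.1 w - ∑ n ∈ s, P n (ξ.1 w)‖ ^ 2 := by
    intro s
    refine (norm_sq_eq_tsum (ξ - ∑ n ∈ s, amplify d (P n) ξ).1).trans (tsum_congr fun w => ?_)
    congr 2
    rw [Submodule.coe_sub, Submodule.coe_sum, lp.coeFn_sub, Pi.sub_apply, lp.coeFn_sum,
      Finset.sum_apply]
    rfl
  have h1 : Filter.Tendsto (fun s : Finset ι => ∑' w, ‖ξ.1 w - ∑ n ∈ s, P n (ξ.1 w)‖ ^ 2)
      Filter.atTop (nhds (∑' _ : Word d, (0 : ℝ))) := by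
    refine tendsto_tsum_of_dominated_convergence (summable_norm_sq ξ.1) (fun w => ?_)
      (Filter.Eventually.of_forall fun s w => ?_)
    · have h2 := (((h (ξ.1 w)).const_sub (ξ.1 w)).norm).pow 2
      simpa using h2
    · rw [Real.norm_of_nonneg (sq_nonneg _)]
      gcongr
      exact hb s _
  rw [tsum_zero] at h1
  simp only [← key] at h1
  have h2 := h1.sqrt
  simp only [Real.sqrt_sq (norm_nonneg _), Real.sqrt_zero] at h2
  have h3 := (tendsto_zero_iff_norm_tendsto_zero.2 h2).const_sub ξ
  simpa [HasSum] using h3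

/-- With a unit vector `c` of `C`, let `B_n` send `x` to `x_n c`. Then `B_n* B_n` is the projection
to the `n`-th coordinate line, these projections sum strongly to `1`, and `Ψ_n = Φ (1 ⊗ B_n)*`
works. One dimension of `C` is enough. -/
theorem exists_hasSum_endomorphisms {ι : Type v} [Nontrivial C]
    {Φ : FreeModule d (lp (fun _ : ι => ℂ) 2) →L[ℂ] FreeModule d C} (hΦ : IsModuleHom Φ) :
    ∃ Ψ : ι → FreeModule d C →L[ℂ] FreeModule d C, (∀ n, IsModuleHom (Ψ n)) ∧
      ∀ ξ, HasSum (fun n => Ψ n ((Ψ n).adjoint ξ)) (Φ (Φ.adjoint ξ)) := by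
  classical
  obtain ⟨c, hc⟩ : ∃ c : C, ‖c‖ = 1 := by
    let _ := NormedSpace.complexToReal (E := C)
    exact exists_norm_eq C zero_le_one
  let e : ι → lp (fun _ : ι => ℂ) 2 := fun n => lp.single 2 n 1
  let B : ι → lp (fun _ : ι => ℂ) 2 →L[ℂ] C := fun n => InnerProductSpace.rankOne ℂ c (e n)
  have hB : ∀ n x, (B n).adjoint (B n x) = lp.single (E := fun _ : ι => ℂ) 2 n (x n) := by
    intro n x
    have h1 : ∀ x, B n x = x n • c := by
      intro x
      simp [B, e, InnerProductSpace.rankOne_apply, lp.inner_single_left]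
    refine ext_inner_right ℂ fun y => ?_
    rw [ContinuousLinearMap.adjoint_inner_left, h1, h1, inner_smul_left, inner_smul_right,
      inner_self_eq_norm_sq_to_K, hc, lp.inner_single_left]
    simp [mul_comm]
  refine ⟨fun n => Φ ∘L (amplify d (B n)).adjoint, fun n f ξ => ?_, fun ξ => ?_⟩
  · rw [ContinuousLinearMap.comp_apply, isModuleHom_adjoint_amplify, hΦ]
    rfl
  · have h2 : HasSum (fun n => amplify d ((B n).adjoint ∘L B n) (Φ.adjoint ξ)) (Φ.adjoint ξ) := by
      refine hasSum_amplify (fun x => ?_) (fun s x => ?_) _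
      · simp only [ContinuousLinearMap.comp_apply, hB]
        exact lp.hasSum_single (by norm_num) x
      · simp only [ContinuousLinearMap.comp_apply, hB]
        have h3 := lp.norm_compl_sum_single (E := fun _ : ι => ℂ) (p := 2) (by norm_num) x s
        simp only [ENNReal.toReal_ofNat, Real.rpow_ofNat] at h3
        refine (sq_le_sq₀ (norm_nonneg _) (norm_nonneg _)).1 (h3.le.trans ?_)
        exact sub_le_self _ (Finset.sum_nonneg fun _ _ => sq_nonneg _)
    have h4 : ∀ n, (Φ ∘L (amplify d (B n)).adjoint).adjoint = amplify d (B n) ∘L Φ.adjoint := by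
      intro n
      rw [ContinuousLinearMap.adjoint_comp, ContinuousLinearMap.adjoint_adjoint]
    have h5 : ∀ n, (Φ ∘L (amplify d (B n)).adjoint) ((Φ ∘L (amplify d (B n)).adjoint).adjoint ξ) =
        Φ (amplify d ((B n).adjoint ∘L B n) (Φ.adjoint ξ)) := by
      intro n
      rw [h4, adjoint_amplify]
      rfl
    have h6 := h2.mapL Φ
    simp only [← h5] at h6
    exact h6

end Amplification

/-! ### Invariant subspaces -/

section Projection

variable {d : ℕ} {C : Type u} [NormedAddCommGroup C] [InnerProductSpace ℂ C] [CompleteSpace C]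

theorem inner_starProjection_self {H : Type u} [NormedAddCommGroup H] [InnerProductSpace ℂ H]
    (M : Submodule ℂ H) [M.HasOrthogonalProjection] (η : H) :
    ⟪M.starProjection η, η⟫_ℂ = (‖M.starProjection η‖ ^ 2 : ℝ) := by
  rw [← Submodule.starProjection_eq_self_iff.2 (Submodule.starProjection_apply_mem M η),
    Submodule.inner_starProjection_left_eq_right,
    Submodule.starProjection_eq_self_iff.2 (Submodule.starProjection_apply_mem M η),
    inner_self_eq_norm_sq_to_K]
  simp

/-- The form of the defect is `‖Pξ‖² - ∑ ‖P T_k* Pξ‖²`, and the row contraction property at `Pξ`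
bounds the sum. -/
theorem isPositive_defect_starProjection {M : ClosedSubmodule ℂ (FreeModule d C)}
    (hM : IsSubmoduleOf M) : (defect M.toSubmodule.starProjection).IsPositive := by
  set P := M.toSubmodule.starProjection with hP
  have hself : IsSelfAdjoint P := isSelfAdjoint_starProjection _
  refine ContinuousLinearMap.isPositive_def'.2 ⟨isSelfAdjoint_defect hself, fun ξ => ?_⟩
  have h1 : ∀ η, ⟪P η, η⟫_ℂ = (‖P η‖ ^ 2 : ℝ) := inner_starProjection_self _
  -- Invariance of `M` under `T_k` says that `T_k*` preserves the orthogonal complement of `M`.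
  have h2 : ∀ (k : Fin d) η, P ((coordMul k).adjoint η) = P ((coordMul k).adjoint (P η)) := by
    intro k η
    rw [← sub_eq_zero, ← map_sub, ← map_sub, hP, Submodule.starProjection_apply_eq_zero_iff,
      Submodule.mem_orthogonal]
    intro μ hμ
    rw [ContinuousLinearMap.adjoint_inner_right]
    refine Submodule.sub_starProjection_mem_orthogonal (K := M.toSubmodule) η _ ?_
    have := hM (MvPolynomial.X k) μ hμ
    rwa [polyRep_X] at this
  change 0 ≤ RCLike.re ⟪defect P ξ, ξ⟫_ℂ
  rw [inner_defect]
  simp only [h1]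
  rw [← Complex.ofReal_sum, ← Complex.ofReal_sub]
  refine sub_nonneg.2 (le_trans (Finset.sum_le_sum fun k _ => ?_)
    (sum_norm_adjoint_coordMul_le (P ξ)))
  rw [h2]
  gcongr
  exact Submodule.norm_starProjection_apply_le _ _

/-- `‖Φ*η‖² = ⟪Pη, η⟫ = ‖Pη‖² = ‖Φ Φ*η‖²`: `Φ` is isometric on the range of its adjoint, whose
closure is the orthogonal complement of the kernel. -/
theorem norm_adjoint_of_starProjection_eq {H : Type v} {K : Type u} [NormedAddCommGroup H]
    [InnerProductSpace ℂ H] [CompleteSpace H] [NormedAddCommGroup K] [InnerProductSpace ℂ K]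
    [CompleteSpace K] {M : Submodule ℂ K} [M.HasOrthogonalProjection] {Φ : H →L[ℂ] K}
    (h : M.starProjection = Φ ∘L Φ.adjoint) (η : K) :
    ‖Φ (Φ.adjoint η)‖ = ‖Φ.adjoint η‖ := by
  have h1 : Φ (Φ.adjoint η) = M.starProjection η := by rw [h]; rfl
  have h2 : ⟪Φ.adjoint η, Φ.adjoint η⟫_ℂ = (‖M.starProjection η‖ ^ 2 : ℝ) := by
    rw [← inner_starProjection_self, ContinuousLinearMap.adjoint_inner_right, h1]
  rw [inner_self_eq_norm_sq_to_K] at h2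
  rw [h1, ← sq_eq_sq₀ (norm_nonneg _) (norm_nonneg _)]
  exact (Complex.ofReal_injective ((Complex.ofReal_pow _ _).trans h2)).symm

theorem isPartialIsometry_of_starProjection_eq {H : Type v} {K : Type u} [NormedAddCommGroup H]
    [InnerProductSpace ℂ H] [CompleteSpace H] [NormedAddCommGroup K] [InnerProductSpace ℂ K]
    [CompleteSpace K] {M : Submodule ℂ K} [M.HasOrthogonalProjection] {Φ : H →L[ℂ] K}
    (h : M.starProjection = Φ ∘L Φ.adjoint) : IsPartialIsometry Φ := by
  intro ξ hξ
  rw [ContinuousLinearMap.orthogonal_ker] at hξ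
  have hc : IsClosed {ξ | ‖Φ ξ‖ = ‖ξ‖} := isClosed_eq (by fun_prop) (by fun_prop)
  refine closure_minimal ?_ hc hξ
  rintro _ ⟨η, rfl⟩
  exact norm_adjoint_of_starProjection_eq h η

theorem norm_le_one_of_starProjection_eq {H : Type v} {K : Type u} [NormedAddCommGroup H]
    [InnerProductSpace ℂ H] [CompleteSpace H] [NormedAddCommGroup K] [InnerProductSpace ℂ K]
    [CompleteSpace K] {M : Submodule ℂ K} [M.HasOrthogonalProjection] {Φ : H →L[ℂ] K}
    (h : M.starProjection = Φ ∘L Φ.adjoint) : ‖Φ‖ ≤ 1 := by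
  rw [← LinearIsometryEquiv.norm_map ContinuousLinearMap.adjoint Φ]
  refine ContinuousLinearMap.opNorm_le_bound _ zero_le_one fun η => ?_
  rw [one_mul, ← norm_adjoint_of_starProjection_eq h]
  have h1 : Φ (Φ.adjoint η) = M.starProjection η := by rw [h]; rfl
  rw [h1]
  exact Submodule.norm_starProjection_apply_le _ _

end Projection

end

/-! ### The equivalence and the corollary -/

theorem theorem5p9 (d : ℕ) (hd : 1 ≤ d) (C : Type u) [NormedAddCommGroup C]
    [InnerProductSpace ℂ C] [CompleteSpace C] [TopologicalSpace.SeparableSpace C] :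
    (∀ X : FreeModule d C →L[ℂ] FreeModule d C,
      [ (dGamma X).IsPositive,
        ∃ Φ : ℕ → (FreeModule d C →L[ℂ] FreeModule d C), (∀ n, IsModuleHom (Φ n)) ∧
          ∀ ξ, HasSum (fun n => Φ n ((Φ n).adjoint ξ)) (X ξ),
        ∃ (E : Type v) (_ : NormedAddCommGroup E) (_ : InnerProductSpace ℂ E)
          (_ : CompleteSpace E) (_ : TopologicalSpace.SeparableSpace E)
          (Φ : FreeModule d E →L[ℂ] FreeModule d C),
          IsModuleHom Φ ∧ X = Φ ∘L Φ.adjoint ].TFAE) ∧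
    (∀ M : ClosedSubmodule ℂ (FreeModule d C), IsSubmoduleOf M →
      ∃ (E : Type v) (_ : NormedAddCommGroup E) (_ : InnerProductSpace ℂ E)
        (_ : CompleteSpace E) (_ : TopologicalSpace.SeparableSpace E)
        (Φ : FreeModule d E →L[ℂ] FreeModule d C),
        IsModuleHom Φ ∧ ‖Φ‖ ≤ 1 ∧ IsPartialIsometry Φ ∧
          M.toSubmodule.starProjection = Φ ∘L Φ.adjoint) := by
  refine ⟨fun X => ?_, fun M hM => ?_⟩
  · rw [isPositive_dGamma_iff hd]
    tfae_have 1 → 2 := by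
      intro h
      -- A zero space `C` has no unit vector to carry the coordinate lines, but then all operators
      -- vanish.
      rcases subsingleton_or_nontrivial C with hC | hC
      · have : Subsingleton (FreeModule d C) := ⟨fun ξ η => by
          ext w
          exact Subsingleton.elim _ _⟩
        refine ⟨fun _ => 0, fun _ _ _ => Subsingleton.elim _ _, fun ξ => ?_⟩
        rw [Subsingleton.elim (X ξ) 0]
        exact hasSum_zero
      · obtain ⟨Φ, hΦ, rfl⟩ := exists_factorization h ℕ
        exact exists_hasSum_endomorphisms hΦ
    tfae_have 2 → 1 := by
      rintro ⟨Φ, hΦ, h⟩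
      exact isPositive_of_hasSum (hasSum_defect (Y := fun n => Φ n ∘L (Φ n).adjoint) h)
        fun n => isPositive_defect_comp_adjoint (hΦ n)
    -- `ULift` places the coefficient space in the universe `v` that the statement asks for.
    tfae_have 1 → 3 := fun h =>
      ⟨lp (fun _ : ULift.{v} ℕ => ℂ) 2, inferInstance, inferInstance, inferInstance,
        lp_separableSpace ℂ, exists_factorization h (ULift.{v} ℕ)⟩
    tfae_have 3 → 1 := by
      rintro ⟨E, _, _, _, _, Φ, hΦ, rfl⟩
      exact isPositive_defect_comp_adjoint hΦ
    tfae_finish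
  · obtain ⟨Φ, hΦ, h⟩ := exists_factorization (isPositive_defect_starProjection hM) (ULift.{v} ℕ)
    exact ⟨lp (fun _ : ULift.{v} ℕ => ℂ) 2, inferInstance, inferInstance, inferInstance,
      lp_separableSpace ℂ, Φ, hΦ, norm_le_one_of_starProjection_eq h,
      isPartialIsometry_of_starProjection_eq h, h⟩
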